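/- **Reduced words.** For a permutation $\pi\in\mathfrak S_n$, $n\ge 0$, let $R(\pi)$ be the set of its reduced words, i.e. the words $i_1i_2\dots i_k$ with letters in $[n-1]$ and $k$ minimal such that $\pi=s_{i_1}s_{i_2}\cdots s_{i_k}$, where $s_i$ exchanges $i$ and $i+1$ and products are compositions of functions (right-most factor first). Let $G_\pi$ be the graph on $R(\pi)$ in which two words are adjacent if one is obtained from the other by a commutation move (exchange adjacent letters $jk$ with $|j-k|>1$) or a long braid move (exchange $j(j+1)j$ and $(j+1)j(j+1)$ on consecutive positions). **Inflation.** For $\alpha\in\mathfrak S_a$ and $\beta\in\mathfrak S_b$, $a,b\ge 0$, let $\pi=21[\alpha,\beta]\in\mathfrak S_{a+b}$ be the permutation with one-line notation $(\alpha_1+b)\cdots(\alpha_a+b)\,\beta_1\cdots\beta_b$. **Words.** Consider words $w=w_1w_2\dots$ in plain letters $j$, underlined letters $\underline j$ and overlined letters $\overline j$. Let $w^{(m)}=w_1\cdots w_m$, and let $N_j(w)$ be the number of plain letters $j$ in $w$. Let $\mathrm{Ballot}_{a,b}$ be the set of rearrangements $x$ of the multiset $\{1^b,2^b,\dots,a^b\}$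 such that $N_j(x^{(m)})\ge N_k(x^{(m)})$ for all $m$ and all $1\le j<k$. Let $f(w)$ be the word obtained from $w$ by replacing each plain letter $w_i=j$ by the plain letter $b-N_j(w^{(i-1)})$ and keeping all underlined and overlined letters. **Vertices.** Let $\underline R(\alpha)$ and $\overline R(\beta)$ be the sets of reduced words of $\alpha$ and $\beta$ with all letters underlined, respectively overlined. Let $V_{\alpha,\beta}$ be the set of all shuffles $w$ of some $x\in\mathrm{Ballot}_{a,b}$, some $u\in\underline R(\alpha)$ and some $v\in\overline R(\beta)$ such that, with $z=f(w)$, 1. if $w_i=\underline j$, then $N_j(w^{(i-1)})=N_{j+1}(w^{(i-1)})$; 2. if $w_i=\overline j$, then $N_j(z^{(i-1)})=N_{j+1}(z^{(i-1)})$. **Edges.** Let $H_{\alpha,\beta}$ be the graph on $V_{\alpha,\beta}$ in which two distinct words are adjacent if one is obtained from the other by one of the following moves on consecutive positions, where $z=f(w)$. 1. Commutation moves, exchanging two adjacent letters: (a) $w_iw_{i+1}=\underline p\,\underline q$ with $|p-q|>1$; (b) $w_iw_{i+1}=\overline p\,\overline q$ with $|p-q|>1$; (c) $w_iw_{i+1}=pq$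 with either $p>q$, or $p<q$ and $N_p(w^{(i-1)})>N_q(w^{(i-1)})$; (d) $w_iw_{i+1}=\underline p\,\overline q$ or $\overline q\,\underline p$, for any $p,q$; (e) $w_iw_{i+1}=\underline p\,q$ or $q\,\underline p$ with $|p-q|>1$ or $p>q$; (f) $z_iz_{i+1}=\overline p\,q$ or $q\,\overline p$ with $|p-q|>1$ or $q<p$ (the exchange is made in $z$). 2. Long braid moves: (a) exchange $\underline p\,\underline{p+1}\,\underline p$ and $\underline{p+1}\,\underline p\,\underline{p+1}$ in $w$; (b) exchange $\overline p\,\overline{p+1}\,\overline p$ and $\overline{p+1}\,\overline p\,\overline{p+1}$ in $w$; (c) exchange $\underline p\,p\,(p+1)$ and $p\,(p+1)\,\underline p$ in $w$; (d) exchange $\overline p\,(p+1)\,p$ and $(p+1)\,p\,\overline p$ in $z$. A move made in $z$ joins $w$ to the word $w'\in V_{\alpha,\beta}$ for which $f(w')$ is the changed word. **The map.** For $w\in V_{\alpha,\beta}$ and $z=f(w)$ let $\psi(w)=r$ be the word of the same length with $$r_i=\begin{cases} j+b-N_j(w^{(i-1)})-1 & \text{if } w_i=j,\\ j+b-N_j(w^{(i-1)})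 & \text{if } w_i=\underline j,\\ j+N_j(z^{(i-1)}) & \text{if } w_i=\overline j.\end{cases}$$ **Theorem.** Let $\alpha\in\mathfrak S_a$, $\beta\in\mathfrak S_b$ and $\pi=21[\alpha,\beta]$. The map $\psi$ is a bijection from $V_{\alpha,\beta}$ onto $R(\pi)$, and it is a graph isomorphism from $H_{\alpha,\beta}$ to $G_\pi$. -/

import Mathlib

namespace Inflation21

/-! Reduced words of permutations and the graph of a permutation -/

/-- The simple reflection `s_i` of the symmetric group on `n` letters (`1 ≤ i ≤ n - 1`), exchanging
the letters `i` and `i + 1`.  The letter `m` of `{1, …, n}` is the element `m - 1` of `Fin n`.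
Outside the range `1 ≤ i ≤ n - 1` the value is irrelevant. -/
def simpleRefl (n i : ℕ) : Equiv.Perm (Fin n) :=
  if h : 1 ≤ i ∧ i < n then Equiv.swap ⟨i - 1, by omega⟩ ⟨i, h.2⟩ else 1

/-- The word `r = i₁ i₂ … i_k` has all its letters in `{1, …, n - 1}` and
`π = s_{i₁} s_{i₂} ⋯ s_{i_k}`. -/
def IsWordOf {n : ℕ} (π : Equiv.Perm (Fin n)) (r : List ℕ) : Prop :=
  (∀ i ∈ r, 1 ≤ i ∧ i < n) ∧ (r.map (simpleRefl n)).prod = π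

/-- The set `R(π)` of reduced words of `π`: the words of minimal length for `π`. -/
def reducedWords {n : ℕ} (π : Equiv.Perm (Fin n)) : Set (List ℕ) :=
  {r | IsWordOf π r ∧ ∀ r', IsWordOf π r' → r.length ≤ r'.length}

/-- `|p - q| > 1`. -/
def Far (p q : ℕ) : Prop := p + 1 < q ∨ q + 1 < p

/-- Commutation move: exchange adjacent letters `j k` with `|j - k| > 1`. -/
def CommMove (r r' : List ℕ) : Prop :=
  ∃ (s t : List ℕ) (j k : ℕ), Far j k ∧ r = s ++ [j, k] ++ t ∧ r' = s ++ [k, j] ++ t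

/-- Long braid move: replace consecutive letters `j (j+1) j` by `(j+1) j (j+1)`. -/
def BraidMove (r r' : List ℕ) : Prop :=
  ∃ (s t : List ℕ) (j : ℕ), r = s ++ [j, j + 1, j] ++ t ∧ r' = s ++ [j + 1, j, j + 1] ++ t

/-- The graph `G_π` on `R(π)`, whose edges are the commutation moves and the long braid moves
(in either direction). -/
def graphG {n : ℕ} (π : Equiv.Perm (Fin n)) : SimpleGraph (reducedWords π) :=
  SimpleGraph.fromRel fun r r' => CommMove r.1 r'.1 ∨ BraidMove r.1 r'.1

/-- The inflation `21[α, β]`.  In one-line notation it is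
`(α₁ + b) (α₂ + b) … (α_a + b) β₁ β₂ … β_b`. -/
def inflation21 {a b : ℕ} (α : Equiv.Perm (Fin a)) (β : Equiv.Perm (Fin b)) :
    Equiv.Perm (Fin (a + b)) :=
  finSumFinEquiv.symm.trans ((Equiv.sumCongr α β).trans
    ((Equiv.sumComm (Fin a) (Fin b)).trans
      (finSumFinEquiv.trans (finCongr (Nat.add_comm b a)))))

theorem inflation21_left {a b : ℕ} (α : Equiv.Perm (Fin a)) (β : Equiv.Perm (Fin b)) (i : Fin a) :
    (inflation21 α β (Fin.castAdd b i) : ℕ) = α i + b := by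
  simp [inflation21, Nat.add_comm]

theorem inflation21_right {a b : ℕ} (α : Equiv.Perm (Fin a)) (β : Equiv.Perm (Fin b))
    (i : Fin b) : (inflation21 α β (Fin.natAdd a i) : ℕ) = β i := by
  simp [inflation21]

/-! Words with plain, underlined and overlined letters -/

/-- A letter: plain `j`, underlined `j` (written `lower j`) or overlined `j` (written `upper j`). -/
inductive Letter : Type
  | plain (j : ℕ) : Letter
  | lower (j : ℕ) : Letter
  | upper (j : ℕ) : Letter
  deriving DecidableEq

open Letter

/-- `N_j(w)`: the number of plain letters `j` in `w`. -/
def N (j : ℕ) (w : List Letter) : ℕ := w.count (plain j)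

/-- The map `f` (for a given `b`): the plain letter `w_i = j` is replaced by the plain letter
`b - N_j(w₁ … w_{i-1})`; underlined and overlined letters are kept.  (Positions of lists are
counted from `0`, so `w.take i` is the part of `w` strictly before position `i`.) -/
def f (b : ℕ) (w : List Letter) : List Letter :=
  w.mapIdx fun i c =>
    match c with
    | plain j => plain (b - N j (w.take i))
    | lower j => lower j
    | upper j => upper j

/-- `x` is a ballot sequence of positive integers: in each prefix, `j` occurs at least as often as
`k` whenever `1 ≤ j < k`. -/
def IsBallot (x : List ℕ) : Prop :=
  (∀ j ∈ x, 1 ≤ j) ∧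
    ∀ j k : ℕ, 1 ≤ j → j < k → ∀ m ≤ x.length, (x.take m).count k ≤ (x.take m).count j

/-- The ballot sequences that are rearrangements of the multiset `{1^b, 2^b, …, a^b}`. -/
def ballot (a b : ℕ) : Set (List ℕ) :=
  {x | IsBallot x ∧ (x : Multiset ℕ) = ∑ i ∈ Finset.Icc 1 a, Multiset.replicate b i}

/-- `IsShuffle x u v w`: the word `w` is a shuffle of the words `x`, `u` and `v`. -/
inductive IsShuffle {A : Type} : List A → List A → List A → List A → Prop
  | nil : IsShuffle [] [] [] []
  | fst {x u v w : List A} (c : A) : IsShuffle x u v w → IsShuffle (c :: x) u v (c :: w)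
  | snd {x u v w : List A} (c : A) : IsShuffle x u v w → IsShuffle x (c :: u) v (c :: w)
  | trd {x u v w : List A} (c : A) : IsShuffle x u v w → IsShuffle x u (c :: v) (c :: w)

/-- The restricted shuffles of a plain word `x`, the underlined word `u` and the overlined
word `v`. -/
def restrictedShuffle (b : ℕ) (x u v : List ℕ) : Set (List Letter) :=
  {w | IsShuffle (x.map plain) (u.map lower) (v.map upper) w ∧
    (∀ i j : ℕ, w[i]? = some (lower j) → N j (w.take i) = N (j + 1) (w.take i)) ∧
    (∀ i j : ℕ, w[i]? = some (upper j) →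
      N j ((f b w).take i) = N (j + 1) ((f b w).take i))}

/-- The vertex set `V_{α,β}`. -/
def vertexSet {a b : ℕ} (α : Equiv.Perm (Fin a)) (β : Equiv.Perm (Fin b)) : Set (List Letter) :=
  ⋃ x ∈ ballot a b, ⋃ u ∈ reducedWords α, ⋃ v ∈ reducedWords β, restrictedShuffle b x u v

/-! The graph `H_{α,β}` -/

/-- The word `w'` arises from `w` by replacing some consecutive letters `p` by the letters `q`. -/
def Replaces (p q w w' : List Letter) : Prop :=
  ∃ s t : List Letter, w = s ++ p ++ t ∧ w' = s ++ q ++ t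

/-- The commutation moves (exchanges of two adjacent letters) from `w` to `w'`. -/
inductive HComm (b : ℕ) (w w' : List Letter) : Prop
  | lowerLower (p q : ℕ) : Far p q →
      Replaces [lower p, lower q] [lower q, lower p] w w' → HComm b w w'
  | upperUpper (p q : ℕ) : Far p q →
      Replaces [upper p, upper q] [upper q, upper p] w w' → HComm b w w'
  | plainPlain (s t : List Letter) (p q : ℕ) : (q < p ∨ (p < q ∧ N q s < N p s)) →
      w = s ++ [plain p, plain q] ++ t → w' = s ++ [plain q, plain p] ++ t → HComm b w w'
  | lowerUpper (p q : ℕ) :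
      Replaces [lower p, upper q] [upper q, lower p] w w' → HComm b w w'
  | lowerPlain (p q : ℕ) : (Far p q ∨ q < p) →
      Replaces [lower p, plain q] [plain q, lower p] w w' → HComm b w w'
  | upperPlain (p q : ℕ) : (Far p q ∨ q < p) →
      Replaces [upper p, plain q] [plain q, upper p] (f b w) (f b w') → HComm b w w'

/-- The long braid moves from `w` to `w'`. -/
inductive HBraid (b : ℕ) (w w' : List Letter) : Prop
  | lowerLower (p : ℕ) :
      Replaces [lower p, lower (p + 1), lower p] [lower (p + 1), lower p, lower (p + 1)] w w' →
      HBraid b w w'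
  | upperUpper (p : ℕ) :
      Replaces [upper p, upper (p + 1), upper p] [upper (p + 1), upper p, upper (p + 1)] w w' →
      HBraid b w w'
  | lowerPlain (p : ℕ) :
      Replaces [lower p, plain p, plain (p + 1)] [plain p, plain (p + 1), lower p] w w' →
      HBraid b w w'
  | upperPlain (p : ℕ) :
      Replaces [upper p, plain (p + 1), plain p] [plain (p + 1), plain p, upper p]
        (f b w) (f b w') →
      HBraid b w w'

/-- The graph `H_{α,β}` on `V_{α,β}`, whose edges are the moves above, in either direction. -/
def graphH {a b : ℕ} (α : Equiv.Perm (Fin a)) (β : Equiv.Perm (Fin b)) :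
    SimpleGraph (vertexSet α β) :=
  SimpleGraph.fromRel fun w w' => HComm b w.1 w'.1 ∨ HBraid b w.1 w'.1

/-- The map `ψ`. On the words of `V_{α,β}` none of the subtractions is truncated: there a plain
letter `j` is preceded by fewer than `b` plain letters `j`. -/
def psi (b : ℕ) (w : List Letter) : List ℕ :=
  w.mapIdx fun i c =>
    match c with
    | plain j => j + b - N j (w.take i) - 1
    | lower j => j + b - N j (w.take i)
    | upper j => j + N j ((f b w).take i)

end Inflation21

/-!
A prefix `s` of a word of `V_{α,β}` determines an arrangement of the entries `1, …, a + b`: at the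
beginning the small entries `1, …, b` stand in front of the large entries `b + 1, …, b + a`, and
each plain letter exchanges a small entry with the large entry next to it. The barred letters
leave the arrangement unchanged and permute the values that the small, respectively large, entries
stand for. The letters that may follow `s` correspond to the pairs of neighbouring positions `i`,
`i + 1` whose entries increase, and `psi` maps such a letter to `i`. As entries of either class
stay in increasing order, the word `psi b w` is reduced exactly if the two barred subwords are, and
every reduced word can be read back letter by letter. Two letters that may follow `s` commute if
and only if they belong to disjoint pairs of positions; they begin a braid move if and only if the
pairs overlap, that is, if three neighbouring entries increase. This matches the edges.
-/

namespace Inflation21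

open Equiv Letter

/-! ### Reduced words and inversions -/

/-- The product of the transpositions of `i` and `i + 1`, for `i` running through a word. On `ℕ`
they do not depend on `n`. -/
def wordPerm (r : List ℕ) : Perm ℕ := (r.map fun i => swap i (i + 1)).prod

@[simp] theorem wordPerm_nil : wordPerm [] = 1 := rfl

@[simp] theorem wordPerm_append (r t : List ℕ) : wordPerm (r ++ t) = wordPerm r * wordPerm t := by
  simp [wordPerm]

@[simp] theorem wordPerm_singleton (i : ℕ) : wordPerm [i] = swap i (i + 1) := by
  simp [wordPerm]

/-- The permutations of `ℕ` that stem from permutations of `{1, …, n}`. -/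
def FixesOutside (n : ℕ) (σ : Perm ℕ) : Prop := ∀ x, ¬ (1 ≤ x ∧ x ≤ n) → σ x = x

namespace FixesOutside

variable {n : ℕ} {σ τ : Perm ℕ}

theorem mul (hσ : FixesOutside n σ) (hτ : FixesOutside n τ) : FixesOutside n (σ * τ) :=
  fun x hx => by rw [Perm.mul_apply, hτ x hx, hσ x hx]

theorem mapsTo (hσ : FixesOutside n σ) {x : ℕ} (hx : 1 ≤ x ∧ x ≤ n) : 1 ≤ σ x ∧ σ x ≤ n := by
  by_contra h
  rw [σ.injective (hσ _ h)] at h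
  exact h hx

theorem ext (hσ : FixesOutside n σ) (hτ : FixesOutside n τ)
    (h : ∀ x, 1 ≤ x ∧ x ≤ n → σ x = τ x) : σ = τ := by
  ext x
  by_cases hx : 1 ≤ x ∧ x ≤ n
  · exact h x hx
  · rw [hσ x hx, hτ x hx]

theorem swap_succ {i : ℕ} (hi : 1 ≤ i ∧ i < n) : FixesOutside n (swap i (i + 1)) :=
  fun x hx => swap_apply_of_ne_of_ne (by omega) (by omega)

theorem wordPerm {r : List ℕ} (hr : ∀ i ∈ r, 1 ≤ i ∧ i < n) : FixesOutside n (wordPerm r) := by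
  induction r using List.reverseRecOn with
  | nil => exact fun _ _ => rfl
  | append_singleton r i ih =>
    rw [wordPerm_append, wordPerm_singleton]
    exact (ih fun j hj => hr j (by simp [hj])).mul (swap_succ (hr i (by simp)))

theorem descent_mem_range (hσ : FixesOutside n σ) {i : ℕ} (h : σ (i + 1) < σ i) :
    1 ≤ i ∧ i < n := by
  have hfix := hσ i
  have hfix' := hσ (i + 1)
  have hmaps := hσ.mapsTo (x := i)
  have hmaps' := hσ.mapsTo (x := i + 1)
  omega

end FixesOutside

/-- The inversions of a permutation among the letters `1, …, n`, as pairs of positions. -/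
def inversions (n : ℕ) (σ : Perm ℕ) : Finset (ℕ × ℕ) :=
  (Finset.Icc 1 n ×ˢ Finset.Icc 1 n).filter fun x => x.1 < x.2 ∧ σ x.2 < σ x.1

theorem mem_inversions {n : ℕ} {σ : Perm ℕ} {x y : ℕ} :
    (x, y) ∈ inversions n σ ↔ (1 ≤ x ∧ x ≤ n) ∧ (1 ≤ y ∧ y ≤ n) ∧ x < y ∧ σ y < σ x := by
  simp [inversions, and_assoc]

theorem inversions_one (n : ℕ) : inversions n 1 = ∅ := by
  ext ⟨x, y⟩
  simp only [mem_inversions, Perm.coe_one, id_eq, Finset.notMem_empty, iff_false]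
  omega

theorem swap_succ_lt_swap_succ {i x y : ℕ} (h : x < y) (hne : ¬ (x = i ∧ y = i + 1)) :
    swap i (i + 1) x < swap i (i + 1) y := by
  simp only [swap_apply_def]
  split_ifs <;> omega

theorem mem_inversions_mul_swap {n i : ℕ} (hi : 1 ≤ i ∧ i < n) {σ : Perm ℕ}
    (h : σ i < σ (i + 1)) {x y : ℕ} :
    (x, y) ∈ inversions n (σ * swap i (i + 1)) ↔
      (x, y) = (i, i + 1) ∨ (swap i (i + 1) x, swap i (i + 1) y) ∈ inversions n σ := by
  have hmaps {x : ℕ} (hx : 1 ≤ x ∧ x ≤ n) := (FixesOutside.swap_succ hi).mapsTo hx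
  rw [mem_inversions, mem_inversions, Prod.mk.injEq]
  simp only [Perm.mul_apply]
  constructor
  · rintro ⟨hx, hy, hxy, hlt⟩
    refine or_iff_not_imp_left.2 fun hne => ?_
    exact ⟨hmaps hx, hmaps hy, swap_succ_lt_swap_succ hxy hne, hlt⟩
  · rintro (⟨rfl, rfl⟩ | ⟨hx, hy, hxy, hlt⟩)
    · exact ⟨by omega, by omega, by omega, by simpa using h⟩
    · have hne : ¬ (swap i (i + 1) x = i ∧ swap i (i + 1) y = i + 1) := by
        rintro ⟨hxi, hyi⟩
        rw [hxi, hyi] at hlt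
        exact hlt.not_gt h
      have hlt' := swap_succ_lt_swap_succ hxy hne
      have hx' := hmaps hx
      have hy' := hmaps hy
      rw [swap_apply_self] at hx' hy'
      rw [swap_apply_self, swap_apply_self] at hlt'
      exact ⟨hx', hy', hlt', hlt⟩

theorem card_inversions_mul_swap {n i : ℕ} (hi : 1 ≤ i ∧ i < n) {σ : Perm ℕ}
    (h : σ i < σ (i + 1)) :
    (inversions n (σ * swap i (i + 1))).card = (inversions n σ).card + 1 := by
  let T : Perm (ℕ × ℕ) := (swap i (i + 1)).prodCongr (swap i (i + 1))
  have hT (z : ℕ × ℕ) : T.symm z = (swap i (i + 1) z.1, swap i (i + 1) z.2) := rfl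
  have hinsert : inversions n (σ * swap i (i + 1)) =
      insert (i, i + 1) ((inversions n σ).map T.toEmbedding) := by
    ext ⟨x, y⟩
    rw [mem_inversions_mul_swap hi h, Finset.mem_insert, Finset.mem_map_equiv, hT]
  rw [hinsert, Finset.card_insert_of_notMem, Finset.card_map]
  rw [Finset.mem_map_equiv, hT, mem_inversions]
  simp

/-- Every letter of the word `w` satisfies the condition `P`, which may depend on the part of `w`
before that letter. -/
def Admissible {A : Type*} (P : List A → A → Prop) (w : List A) : Prop :=
  ∀ s c t, w = s ++ c :: t → P s c

namespace Admissible

variable {A : Type*} {P : List A → A → Prop} {s t w : List A} {c : A}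

theorem nil : Admissible P [] := fun s c t h => by simp at h

theorem left (h : Admissible P (s ++ t)) : Admissible P s := fun s' c t' hs =>
  h s' c (t' ++ t) (by simp [hs])

theorem concat_iff : Admissible P (w ++ [c]) ↔ Admissible P w ∧ P w c := by
  refine ⟨fun h => ⟨h.left, h w c [] rfl⟩, fun ⟨hw, hc⟩ s d t hst => ?_⟩
  rcases List.eq_nil_or_concat t with rfl | ⟨t', x, rfl⟩
  · obtain ⟨rfl, hcd⟩ := List.append_inj' hst rfl
    rwa [← List.singleton_inj.1 hcd]
  · have hst' : w ++ [c] = (s ++ d :: t') ++ [x] := by simpa using hst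
    exact hw s d t' (List.append_inj' hst' rfl).1

@[elab_as_elim]
theorem induction {motive : ∀ w, Admissible P w → Prop} (nil : motive [] nil)
    (concat : ∀ s c (hs : Admissible P s) (hc : P s c), motive s hs →
      motive (s ++ [c]) (concat_iff.2 ⟨hs, hc⟩)) (hw : Admissible P w) : motive w hw := by
  induction w using List.reverseRecOn with
  | nil => exact nil
  | append_singleton s c ih =>
    obtain ⟨hs, hc⟩ := concat_iff.1 hw
    exact concat s c hs hc (ih hs)

end Admissible

/-- Each letter of the word exchanges two values that stand in increasing order; these are the
reduced words of the symmetric groups. -/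
abbrev Ascending (r : List ℕ) : Prop :=
  Admissible (fun s i => wordPerm s i < wordPerm s (i + 1)) r

theorem ascending_concat_iff {r : List ℕ} {i : ℕ} :
    Ascending (r ++ [i]) ↔ Ascending r ∧ wordPerm r i < wordPerm r (i + 1) :=
  Admissible.concat_iff

theorem card_inversions_wordPerm {n : ℕ} {r : List ℕ} (hr : ∀ i ∈ r, 1 ≤ i ∧ i < n) :
    (inversions n (wordPerm r)).card ≤ r.length ∧
      ((inversions n (wordPerm r)).card = r.length ↔ Ascending r) := by
  induction r using List.reverseRecOn with
  | nil => simp [inversions_one, Admissible.nil]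
  | append_singleton r i ih =>
    obtain ⟨hle, heq⟩ := ih fun j hj => hr j (by simp [hj])
    have hi := hr i (by simp)
    rw [ascending_concat_iff, ← heq, wordPerm_append, wordPerm_singleton, List.length_append,
      List.length_singleton]
    rcases ((wordPerm r).injective.ne (Nat.lt_add_one i).ne).lt_or_gt with h | h
    · have hcard := card_inversions_mul_swap hi h
      omega
    · have hcard :=
        card_inversions_mul_swap hi (σ := wordPerm r * swap i (i + 1)) (by simpa using h)
      rw [mul_swap_mul_self] at hcard
      omega

theorem eq_one_of_forall_lt {σ : Perm ℕ} (h : ∀ i, σ i < σ (i + 1)) : σ = 1 := by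
  have hσ : StrictMono σ := strictMono_nat_of_lt_succ h
  have hσ' : StrictMono σ.symm := fun x y hxy => by
    rw [← hσ.lt_iff_lt]
    simpa using hxy
  ext x
  exact le_antisymm (by simpa using hσ'.le_apply (x := σ x)) hσ.le_apply

theorem exists_word_of_fixesOutside {n : ℕ} {σ : Perm ℕ} (hσ : FixesOutside n σ) :
    ∃ r : List ℕ, (∀ i ∈ r, 1 ≤ i ∧ i < n) ∧ wordPerm r = σ ∧
      r.length = (inversions n σ).card := by
  induction hk : (inversions n σ).card using Nat.strong_induction_on generalizing σ with
  | _ k ih =>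
  by_cases hdesc : ∃ i, σ (i + 1) < σ i
  · obtain ⟨i, hlt⟩ := hdesc
    have hi := hσ.descent_mem_range hlt
    have hcard := card_inversions_mul_swap hi (σ := σ * swap i (i + 1)) (by simpa using hlt)
    rw [mul_swap_mul_self] at hcard
    obtain ⟨r, hr, hrσ, hlen⟩ := ih _ (by omega) (hσ.mul (.swap_succ hi)) rfl
    refine ⟨r ++ [i], ?_, ?_, ?_⟩
    · simpa only [List.forall_mem_append, List.forall_mem_singleton] using ⟨hr, hi⟩
    · rw [wordPerm_append, hrσ, wordPerm_singleton, mul_swap_mul_self]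
    · rw [List.length_append, List.length_singleton, hlen, ← hk, hcard]
  · simp only [not_exists, not_lt] at hdesc
    obtain rfl : σ = 1 := eq_one_of_forall_lt fun i =>
      (hdesc i).lt_of_ne (σ.injective.ne (Nat.lt_add_one i).ne)
    exact ⟨[], by simp, rfl, by rw [← hk, inversions_one]; rfl⟩

/-- The elements of `Fin n` as the letters `1, …, n`. -/
def finEquivLetters (n : ℕ) : Fin n ≃ {k : ℕ // 1 ≤ k ∧ k ≤ n} where
  toFun i := ⟨i + 1, by omega, by omega⟩
  invFun k := ⟨k.1 - 1, by have := k.2; omega⟩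
  left_inv i := by simp
  right_inv k := Subtype.ext (Nat.sub_add_cancel k.2.1)

/-- A permutation of `Fin n` as a permutation of `ℕ` that permutes the letters `1, …, n`. -/
def natPerm (n : ℕ) : Perm (Fin n) →* Perm ℕ := Perm.extendDomainHom (finEquivLetters n)

theorem natPerm_injective (n : ℕ) : Function.Injective (natPerm n) :=
  Perm.extendDomainHom_injective _

theorem natPerm_apply {n : ℕ} (π : Perm (Fin n)) (i : Fin n) :
    natPerm n π ((i : ℕ) + 1) = (π i : ℕ) + 1 :=
  Perm.extendDomain_apply_image π (finEquivLetters n) i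

theorem FixesOutside.natPerm {n : ℕ} (π : Perm (Fin n)) : FixesOutside n (natPerm n π) :=
  fun _ hx => Perm.extendDomain_apply_not_subtype π (finEquivLetters n) hx

theorem natPerm_eq_iff {n : ℕ} (π : Perm (Fin n)) {σ : Perm ℕ} (hσ : FixesOutside n σ) :
    natPerm n π = σ ↔ ∀ i : Fin n, (π i : ℕ) + 1 = σ (i + 1) := by
  refine ⟨fun h i => by rw [← h, natPerm_apply], fun h => (FixesOutside.natPerm π).ext hσ ?_⟩
  rintro x ⟨hx, hxn⟩
  obtain ⟨k, rfl⟩ := Nat.exists_eq_add_of_le' hx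
  rw [← h ⟨k, hxn⟩, ← natPerm_apply]

theorem natPerm_simpleRefl {n i : ℕ} (hi : 1 ≤ i ∧ i < n) :
    natPerm n (simpleRefl n i) = swap i (i + 1) := by
  refine (natPerm_eq_iff _ (.swap_succ hi)).2 fun k => ?_
  simp only [simpleRefl, dif_pos hi, swap_apply_def, Fin.ext_iff, apply_ite Fin.val]
  split_ifs <;> omega

theorem isWordOf_iff {n : ℕ} {π : Perm (Fin n)} {r : List ℕ} :
    IsWordOf π r ↔ (∀ i ∈ r, 1 ≤ i ∧ i < n) ∧ wordPerm r = natPerm n π := by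
  refine and_congr_right fun hr => ?_
  have hmap : r.map (natPerm n ∘ simpleRefl n) = r.map fun i => swap i (i + 1) :=
    List.map_congr_left fun i hi => natPerm_simpleRefl (hr i hi)
  rw [← (natPerm_injective n).eq_iff, map_list_prod, List.map_map, hmap, wordPerm]

theorem mem_reducedWords_iff {n : ℕ} {π : Perm (Fin n)} {r : List ℕ} :
    r ∈ reducedWords π ↔
      (∀ i ∈ r, 1 ≤ i ∧ i < n) ∧ wordPerm r = natPerm n π ∧ Ascending r := by
  rw [reducedWords, Set.mem_ofPred_eq, isWordOf_iff, and_assoc]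
  refine and_congr_right fun hr => and_congr_right fun hπ => ?_
  obtain ⟨hle, heq⟩ := card_inversions_wordPerm hr
  rw [← heq, hπ]
  rw [hπ] at hle
  constructor
  · intro hmin
    obtain ⟨r', hr', hσ, hlen⟩ := exists_word_of_fixesOutside (.natPerm π)
    exact le_antisymm hle (hlen ▸ hmin r' (isWordOf_iff.2 ⟨hr', hσ⟩))
  · intro hlen r' hr'
    obtain ⟨hr', hπ'⟩ := isWordOf_iff.1 hr'
    rw [← hlen, ← hπ']
    exact (card_inversions_wordPerm hr').1

/-! ### The letters that may follow a prefix -/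

/-- The word obtained from `t` by applying `g p` to each letter, where `p` consists of `s` and of
the part of `t` before that letter. Both `f` and `psi` are of this form, with `s` empty. -/
def scan {A B : Type*} (g : List A → A → B) (s t : List A) : List B :=
  t.mapIdx fun i c => g (s ++ t.take i) c

section Scan

variable {A B : Type*} {g : List A → A → B} {s t t' : List A}

@[simp] theorem scan_nil : scan g s [] = [] := rfl

@[simp] theorem scan_cons {c : A} : scan g s (c :: t) = g s c :: scan g (s ++ [c]) t := by
  simp [scan, List.mapIdx_cons]

@[simp] theorem length_scan : (scan g s t).length = t.length := List.length_mapIdx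

theorem scan_append : scan g s (t ++ t') = scan g s t ++ scan g (s ++ t) t' := by
  induction t generalizing s with
  | nil => simp
  | cons c t ih => simp [ih]

theorem take_scan (m : ℕ) : (scan g s t).take m = scan g s (t.take m) := by
  induction t generalizing s m with
  | nil => simp
  | cons c t ih => cases m <;> simp [ih]

theorem exists_of_scan_eq_append {S T : List B} (h : scan g s t = S ++ T) :
    ∃ t₁ t₂, t = t₁ ++ t₂ ∧ scan g s t₁ = S ∧ scan g (s ++ t₁) t₂ = T := by
  have hlen : S.length ≤ t.length := by
    rw [← length_scan (g := g) (s := s) (t := t), h, List.length_append]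
    exact Nat.le_add_right _ _
  rw [← List.take_append_drop S.length t, scan_append] at h
  obtain ⟨hS, hT⟩ := List.append_inj h (by simpa using hlen)
  exact ⟨_, _, (List.take_append_drop S.length t).symm, hS, hT⟩

theorem injOn_scan {P : List A → A → Prop}
    (hg : ∀ s, Admissible P s → Set.InjOn (g s) {c | P s c}) :
    Set.InjOn (scan g []) {w | Admissible P w} := by
  intro w hw w' hw' heq
  have hlen : w.length = w'.length := by simpa using congrArg List.length heq
  induction w using List.reverseRecOn generalizing w' with
  | nil => exact (List.length_eq_zero_iff.1 hlen.symm).symm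
  | append_singleton s c ih =>
    rcases List.eq_nil_or_concat' w' with rfl | ⟨s', c', rfl⟩
    · simp at hlen
    · obtain ⟨hs, hc⟩ := Admissible.concat_iff.1 hw
      obtain ⟨hs', hc'⟩ := Admissible.concat_iff.1 hw'
      rw [scan_append, scan_append] at heq
      obtain ⟨hss, hcc⟩ := List.append_inj' heq rfl
      obtain rfl := ih hs hs' hss (by simpa using hlen)
      rw [hg s hs hc hc' (by simpa using hcc)]

end Scan

/-- The letter of `f b (s ++ [c])` that comes from its last letter `c`. -/
def fLetter (b : ℕ) (s : List Letter) : Letter → Letter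
  | plain j => plain (b - N j s)
  | lower j => lower j
  | upper j => upper j

/-- The letter of `psi b (s ++ [c])` that comes from its last letter `c`. -/
def psiLetter (b : ℕ) (s : List Letter) : Letter → ℕ
  | plain j => j + b - N j s - 1
  | lower j => j + b - N j s
  | upper j => j + N j (f b s)

theorem f_eq_scan (b : ℕ) (w : List Letter) : f b w = scan (fLetter b) [] w := by
  rw [f, scan]
  congr with i c

theorem psi_eq_scan (b : ℕ) (w : List Letter) : psi b w = scan (psiLetter b) [] w := by
  rw [psi, scan]
  congr with i c
  cases c <;> simp [psiLetter, f_eq_scan, take_scan]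

@[simp] theorem f_nil (b : ℕ) : f b [] = [] := rfl

@[simp] theorem psi_nil (b : ℕ) : psi b [] = [] := rfl

theorem f_append (b : ℕ) (s t : List Letter) : f b (s ++ t) = f b s ++ scan (fLetter b) s t := by
  rw [f_eq_scan, f_eq_scan, scan_append, List.nil_append]

theorem psi_append (b : ℕ) (s t : List Letter) :
    psi b (s ++ t) = psi b s ++ scan (psiLetter b) s t := by
  rw [psi_eq_scan, psi_eq_scan, scan_append, List.nil_append]

section Counts

variable {a b : ℕ} {s s' : List Letter} {c : Letter}

@[simp] theorem N_nil (j : ℕ) : N j [] = 0 := rfl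

@[simp] theorem N_append (j : ℕ) (s t : List Letter) : N j (s ++ t) = N j s + N j t :=
  List.count_append

@[simp] theorem N_plain (j p : ℕ) : N j [plain p] = if p = j then 1 else 0 := by
  simp [N, List.count_singleton]

@[simp] theorem N_lower (j p : ℕ) : N j [lower p] = 0 := by simp [N]

@[simp] theorem N_upper (j p : ℕ) : N j [upper p] = 0 := by simp [N]

theorem N_concat_plain (j p : ℕ) (s : List Letter) :
    N j (s ++ [plain p]) = N j s + if p = j then 1 else 0 := by simp

theorem N_f_concat_plain (b j p : ℕ) (s : List Letter) :
    N j (f b (s ++ [plain p])) = N j (f b s) + if b - N p s = j then 1 else 0 := by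
  simp [f_append, fLetter]

/-- The numbers of plain letters `j` in `s` and in `f b s`, for all `j`. The conditions on a letter
and its images under `f` and `psi` depend on the word before it only through these numbers. -/
def counts (b : ℕ) (s : List Letter) : ℕ → ℕ × ℕ := fun j => (N j s, N j (f b s))

theorem counts_eq_iff :
    counts b s = counts b s' ↔ ∀ j, N j s = N j s' ∧ N j (f b s) = N j (f b s') := by
  simp only [funext_iff, counts, Prod.mk.injEq]

/-- A letter other than a plain one. -/
inductive IsBarred : Letter → Prop
  | lower (j : ℕ) : IsBarred (lower j)
  | upper (j : ℕ) : IsBarred (upper j)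

theorem IsBarred.counts_concat (hc : IsBarred c) : counts b (s ++ [c]) = counts b s := by
  cases hc <;> simp [counts_eq_iff, f_append, fLetter]

theorem fLetter_congr (h : counts b s = counts b s') : fLetter b s c = fLetter b s' c := by
  rw [counts_eq_iff] at h
  cases c <;> simp only [fLetter, (h _).1]

theorem psiLetter_congr (h : counts b s = counts b s') : psiLetter b s c = psiLetter b s' c := by
  rw [counts_eq_iff] at h
  cases c <;> simp only [psiLetter, (h _).1, (h _).2]

theorem counts_concat_congr (h : counts b s = counts b s') :
    counts b (s ++ [c]) = counts b (s' ++ [c]) := by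
  have hc := fLetter_congr (c := c) h
  rw [counts_eq_iff] at h ⊢
  exact fun j => by simp [f_append, hc, h j]

theorem scan_congr {B : Type*} {g : List Letter → Letter → B}
    (hg : ∀ s s' c, counts b s = counts b s' → g s c = g s' c) (h : counts b s = counts b s')
    (t : List Letter) : scan g s t = scan g s' t := by
  induction t generalizing s s' with
  | nil => rfl
  | cons c t ih => rw [scan_cons, scan_cons, hg s s' c h, ih (counts_concat_congr h)]

/-- The condition on a letter `c` of a word of `V_{α,β}` in terms of the part `s` before it, where
the ranges of the letters and the ballot condition are included. -/
def CanFollow (a b : ℕ) (s : List Letter) : Letter → Prop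
  | plain j => (1 ≤ j ∧ j ≤ a) ∧ N j s < b ∧ ∀ k, 1 ≤ k → k < j → N j s < N k s
  | lower j => (1 ≤ j ∧ j < a) ∧ N j s = N (j + 1) s
  | upper j => (1 ≤ j ∧ j < b) ∧ N j (f b s) = N (j + 1) (f b s)

/-- The words whose letters satisfy the conditions on the letters of a word of `V_{α,β}`. The plain
letters need not be exhausted, and the barred subwords need not be reduced. -/
abbrev Valid (a b : ℕ) (w : List Letter) : Prop := Admissible (CanFollow a b) w

theorem valid_concat_iff : Valid a b (s ++ [c]) ↔ Valid a b s ∧ CanFollow a b s c :=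
  Admissible.concat_iff

theorem canFollow_congr (h : counts b s = counts b s') :
    CanFollow a b s c ↔ CanFollow a b s' c := by
  rw [counts_eq_iff] at h
  cases c <;> simp only [CanFollow, fun j => (h j).1, fun j => (h j).2]

theorem Valid.append_congr {t : List Letter} (hv : Valid a b (s ++ t))
    (h : counts b s = counts b s') (hs' : Valid a b s') : Valid a b (s' ++ t) := by
  induction t generalizing s s' with
  | nil => simpa using hs'
  | cons c t ih =>
    rw [List.append_cons] at hv ⊢
    have hc := (valid_concat_iff.1 hv.left).2
    exact ih hv (counts_concat_congr h) (valid_concat_iff.2 ⟨hs', (canFollow_congr h).1 hc⟩)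

end Counts

/-- The numbers of plain letters of `s` and of `f b s` are conjugate partitions in an `a × b` box,
the second one written backwards. -/
structure ConjugateCounts (a b : ℕ) (s : List Letter) : Prop where
  le : ∀ j, N j s ≤ b
  range : ∀ j, N j s ≠ 0 → 1 ≤ j ∧ j ≤ a
  anti : ∀ j k, 1 ≤ j → j ≤ k → N k s ≤ N j s
  f_range : ∀ k, N k (f b s) ≠ 0 → 1 ≤ k ∧ k ≤ b
  f_le : ∀ k, N k (f b s) ≤ a
  galois : ∀ j k, 1 ≤ j → j ≤ a → 1 ≤ k → k ≤ b → (j ≤ N k (f b s) ↔ b < N j s + k)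

namespace ConjugateCounts

variable {a b : ℕ} {s s' : List Letter} {p : ℕ}

theorem nil : ConjugateCounts a b [] where
  le := by simp
  range := by simp
  anti := by simp
  f_range := by simp
  f_le := by simp
  galois j k := by simp only [N_nil, f_nil]; omega

theorem congr (hs : ConjugateCounts a b s) (h : counts b s = counts b s') :
    ConjugateCounts a b s' := by
  rw [counts_eq_iff] at h
  obtain ⟨h₁, h₂, h₃, h₄, h₅, h₆⟩ := hs
  simp only [fun j => (h j).1, fun j => (h j).2] at h₁ h₂ h₃ h₄ h₅ h₆
  exact ⟨h₁, h₂, h₃, h₄, h₅, h₆⟩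

theorem plain_partner (h : ConjugateCounts a b s) (hp : CanFollow a b s (plain p)) :
    N (b - N p s) (f b s) + 1 = p := by
  obtain ⟨hp, hpb, hlt⟩ := hp
  have hgalois := h.galois p (b - N p s) (by omega) (by omega) (by omega) (by omega)
  rcases hp.1.eq_or_lt with rfl | hp1
  · omega
  · have hgalois' := h.galois (p - 1) (b - N p s) (by omega) (by omega) (by omega) (by omega)
    have hlt' := hlt (p - 1) (by omega) (by omega)
    omega

theorem concat_plain (h : ConjugateCounts a b s) (hp : CanFollow a b s (plain p)) :
    ConjugateCounts a b (s ++ [plain p]) := by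
  have hpart := h.plain_partner hp
  obtain ⟨hp, hpb, hlt⟩ := hp
  constructor
  case le | range | f_range | f_le =>
    intro k
    have := h.le k
    have := h.range k
    have := h.f_range k
    have := h.f_le k
    simp only [N_concat_plain, N_f_concat_plain]
    grind
  case anti =>
    intro j k hj hjk
    have hanti := h.anti j k hj hjk
    simp only [N_concat_plain]
    grind
  case galois =>
    intro j k hj hja hk hkb
    have hgalois := h.galois j k hj hja hk hkb
    simp only [N_concat_plain, N_f_concat_plain]
    grind

end ConjugateCounts

theorem Valid.conjugateCounts {a b : ℕ} {w : List Letter} (hw : Valid a b w) :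
    ConjugateCounts a b w := by
  induction hw using Admissible.induction with
  | nil => exact .nil
  | concat s c _ hc ih =>
    cases c with
    | plain p => exact ih.concat_plain hc
    | lower p => exact ih.congr (IsBarred.lower p).counts_concat.symm
    | upper p => exact ih.congr (IsBarred.upper p).counts_concat.symm

theorem Valid.counts_eq {a b : ℕ} {s s' : List Letter} (hs : Valid a b s) (hs' : Valid a b s')
    (hN : ∀ j, N j s = N j s') : counts b s = counts b s' := by
  have hle {t t'} (ht : ConjugateCounts a b t) (ht' : ConjugateCounts a b t')
      (hN : ∀ j, N j t = N j t') (k : ℕ) : N k (f b t) ≤ N k (f b t') := by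
    by_cases h0 : N k (f b t) = 0
    · exact h0 ▸ Nat.zero_le _
    · have hk := ht.f_range k h0
      have hgalois := ht.galois _ k (Nat.pos_of_ne_zero h0) (ht.f_le k) hk.1 hk.2
      rwa [hN, ← ht'.galois _ k (Nat.pos_of_ne_zero h0) (ht.f_le k) hk.1 hk.2,
        iff_true_left le_rfl] at hgalois
  exact counts_eq_iff.2 fun j => ⟨hN j,
    (hle hs.conjugateCounts hs'.conjugateCounts hN j).antisymm
      (hle hs'.conjugateCounts hs.conjugateCounts (fun i => (hN i).symm) j)⟩

/-! ### The arrangement of the entries -/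

section Arrangement

variable {a b : ℕ}

/-- The position of the entry `x` in the arrangement of `1, …, a + b` that belongs to a word `s`.
The small entries `1, …, b` start in front of the large entries `b + 1, …, b + a`, and each plain
letter `j` moves the large entry `b + j` one step to the left, past a small one. -/
def pos (b : ℕ) (s : List Letter) (x : ℕ) : ℕ :=
  if x ≤ b then x + N x (f b s) else x - N (x - b) s

/-- The letter exchanges the entries `x` and `y`: a plain letter exchanges their positions, a barred
letter exchanges the values they stand for. A plain letter `j` may exchange `b + j` with any small
entry. -/
def Exchanges (a b : ℕ) : Letter → ℕ → ℕ → Prop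
  | plain j, x, y => (1 ≤ j ∧ j ≤ a) ∧ (1 ≤ x ∧ x ≤ b) ∧ y = b + j
  | lower j, x, y => (1 ≤ j ∧ j < a) ∧ x = b + j ∧ y = b + j + 1
  | upper j, x, y => (1 ≤ j ∧ j < b) ∧ x = j ∧ y = j + 1

namespace Exchanges

variable {c c' : Letter} {x y : ℕ}

theorem mem_range (h : Exchanges a b c x y) : 1 ≤ x ∧ x < y ∧ y ≤ a + b := by
  cases c <;> simp only [Exchanges] at h <;> omega

theorem letter_unique (h : Exchanges a b c x y) (h' : Exchanges a b c' x y) : c = c' := by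
  cases c <;> cases c' <;> simp only [Exchanges, plain.injEq, lower.injEq, upper.injEq] at h h' ⊢
    <;> omega

end Exchanges

theorem pos_congr {s s' : List Letter} (h : counts b s = counts b s') : pos b s = pos b s' := by
  rw [counts_eq_iff] at h
  funext x
  simp only [pos, h]

theorem pos_of_le {s : List Letter} {x : ℕ} (hx : x ≤ b) : pos b s x = x + N x (f b s) :=
  if_pos hx

theorem pos_add {s : List Letter} {p : ℕ} (hp : 1 ≤ p) : pos b s (b + p) = b + p - N p s := by
  rw [pos, if_neg (by omega), Nat.add_sub_cancel_left]

namespace ConjugateCounts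

variable {s : List Letter} {c : Letter} {x y i : ℕ}

theorem pos_mem_iff (h : ConjugateCounts a b s) :
    1 ≤ pos b s x ∧ pos b s x ≤ a + b ↔ 1 ≤ x ∧ x ≤ a + b := by
  have hle := h.le (x - b)
  have hrange := h.range (x - b)
  have hf_le := h.f_le x
  have hf_range := h.f_range x
  unfold pos
  split_ifs <;> omega

theorem pos_lt_pos (h : ConjugateCounts a b s) (hxy : x < y) (hclass : y ≤ b ∨ b < x) :
    pos b s x < pos b s y := by
  rcases hclass with hy | hx
  · rw [pos, pos, if_pos hy, if_pos (hxy.le.trans hy)]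
    by_cases h0 : N x (f b s) = 0
    · omega
    · have hx := h.f_range x h0
      have hgalois := h.galois _ x (Nat.pos_of_ne_zero h0) (h.f_le x) hx.1 hx.2
      have hgalois' := h.galois _ y (Nat.pos_of_ne_zero h0) (h.f_le x) (by omega) hy
      omega
  · have hanti := h.anti (x - b) (y - b) (by omega) (by omega)
    have hle := h.le (x - b)
    rw [pos, pos, if_neg (by omega), if_neg (by omega)]
    omega

theorem eq_succ_of_pos_eq_succ (h : ConjugateCounts a b s) (hxy : x < y)
    (hclass : y ≤ b ∨ b < x) (hpos : pos b s y = pos b s x + 1) : y = x + 1 := by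
  by_contra hne
  have hlt := h.pos_lt_pos (Nat.lt_add_one x) (by omega)
  have hlt' := h.pos_lt_pos (x := x + 1) (y := y) (by omega) (by omega)
  omega

theorem exists_exchanges (h : ConjugateCounts a b s) (hx : 1 ≤ x) (hxy : x < y)
    (hy : y ≤ a + b) (hpos : pos b s y = pos b s x + 1) : ∃ c, Exchanges a b c x y := by
  by_cases hclass : y ≤ b ∨ b < x
  · obtain rfl := h.eq_succ_of_pos_eq_succ hxy hclass hpos
    rcases hclass with hb | hb
    · exact ⟨upper x, ⟨hx, hb⟩, rfl, rfl⟩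
    · exact ⟨lower (x - b), ⟨by omega, by omega⟩, by omega, by omega⟩
  · exact ⟨plain (y - b), ⟨by omega, by omega⟩, ⟨hx, by omega⟩, by omega⟩

theorem plain_exchanges (h : ConjugateCounts a b s) {p : ℕ} (hp : CanFollow a b s (plain p)) :
    Exchanges a b (plain p) (b - N p s) (b + p) ∧ pos b s (b - N p s) = psiLetter b s (plain p) ∧
      pos b s (b + p) = psiLetter b s (plain p) + 1 := by
  have hpart := h.plain_partner hp
  obtain ⟨hp, hpb, -⟩ := hp
  rw [pos_of_le (Nat.sub_le _ _), pos_add hp.1, psiLetter]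
  exact ⟨⟨hp, by omega, rfl⟩, by omega, by omega⟩

theorem canFollow_plain (h : ConjugateCounts a b s) {p : ℕ}
    (hc : Exchanges a b (plain p) x y) (hpos : pos b s y = pos b s x + 1) :
    CanFollow a b s (plain p) ∧ b - N p s = x := by
  obtain ⟨hp, hx, rfl⟩ := hc
  have hgalois := h.galois p x hp.1 hp.2 hx.1 hx.2
  have hle := h.le p
  rw [pos_of_le hx.2, pos_add hp.1] at hpos
  refine ⟨⟨hp, by omega, fun j hj hjp => ?_⟩, by omega⟩
  have hgalois' := h.galois j x hj (by omega) hx.1 hx.2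
  omega

theorem canFollow_iff (h : ConjugateCounts a b s) :
    CanFollow a b s c ∧ psiLetter b s c = i ↔
      ∃ x y, Exchanges a b c x y ∧ pos b s x = i ∧ pos b s y = i + 1 := by
  cases c with
  | plain p =>
    refine ⟨fun ⟨hp, hi⟩ => ⟨_, _, hi ▸ h.plain_exchanges hp⟩, ?_⟩
    rintro ⟨x, y, hc, rfl, hy⟩
    obtain ⟨hp, rfl⟩ := h.canFollow_plain hc hy
    exact ⟨hp, (h.plain_exchanges hp).2.1.symm⟩
  | lower p =>
    have hle := h.le p
    have hle' := h.le (p + 1)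
    constructor
    · rintro ⟨⟨hp, hN⟩, rfl⟩
      refine ⟨_, _, ⟨hp, rfl, rfl⟩, ?_⟩
      rw [add_assoc, pos_add hp.1, pos_add (Nat.le_add_left 1 p), psiLetter]
      omega
    · rintro ⟨_, _, ⟨hp, rfl, rfl⟩, hx, hy⟩
      rw [add_assoc, pos_add (Nat.le_add_left 1 p)] at hy
      rw [pos_add hp.1] at hx
      exact ⟨⟨hp, by omega⟩, by rw [psiLetter]; omega⟩
  | upper p =>
    constructor
    · rintro ⟨⟨hp, hN⟩, rfl⟩
      refine ⟨_, _, ⟨hp, rfl, rfl⟩, ?_⟩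
      rw [pos_of_le hp.2.le, pos_of_le (x := p + 1) hp.2, psiLetter]
      omega
    · rintro ⟨p, _, ⟨hp, rfl, rfl⟩, hx, hy⟩
      rw [pos_of_le (x := p + 1) hp.2] at hy
      rw [pos_of_le hp.2.le] at hx
      exact ⟨⟨hp, by omega⟩, by rw [psiLetter]; omega⟩

end ConjugateCounts

section Positions

variable {s w : List Letter} {c c' : Letter} {x y i : ℕ}

theorem pos_nil : pos b [] = id := by
  funext x
  simp [pos]

theorem IsBarred.pos_concat (hc : IsBarred c) : pos b (s ++ [c]) = pos b s :=
  pos_congr hc.counts_concat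

theorem pos_concat_plain (hs : Valid a b s) {p : ℕ} (hp : CanFollow a b s (plain p)) :
    pos b (s ++ [plain p]) = pos b s ∘ swap (b - N p s) (b + p) := by
  have hpart := hs.conjugateCounts.plain_partner hp
  obtain ⟨hp, hpb, -⟩ := hp
  have hle := hs.conjugateCounts.le p
  funext x
  simp only [pos, Function.comp_apply, swap_apply_def, N_concat_plain, N_f_concat_plain]
  grind

theorem Valid.pos_bijective (hs : Valid a b s) : Function.Bijective (pos b s) := by
  induction hs using Admissible.induction with
  | nil => exact pos_nil ▸ Function.bijective_id
  | concat s c hs hc ih =>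
    cases c with
    | plain p => exact pos_concat_plain hs hc ▸ ih.comp (Equiv.bijective _)
    | lower p => rwa [(IsBarred.lower p).pos_concat]
    | upper p => rwa [(IsBarred.upper p).pos_concat]

theorem Valid.canFollow_iff (hs : Valid a b s) :
    CanFollow a b s c ∧ psiLetter b s c = i ↔
      ∃ x y, Exchanges a b c x y ∧ pos b s x = i ∧ pos b s y = i + 1 :=
  hs.conjugateCounts.canFollow_iff

theorem Valid.psiLetter_injOn (hs : Valid a b s) :
    Set.InjOn (psiLetter b s) {c | CanFollow a b s c} := by
  intro c hc c' hc' heq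
  obtain ⟨x, y, hcxy, hx, hy⟩ := hs.canFollow_iff.1 ⟨hc, rfl⟩
  obtain ⟨x', y', hcxy', hx', hy'⟩ := hs.canFollow_iff.1 ⟨hc', rfl⟩
  obtain rfl := hs.pos_bijective.injective (hx.trans (heq.trans hx'.symm))
  obtain rfl := hs.pos_bijective.injective (hy.trans (heq ▸ hy'.symm))
  exact hcxy.letter_unique hcxy'

theorem Valid.fLetter_injOn (hs : Valid a b s) :
    Set.InjOn (fLetter b s) {c | CanFollow a b s c} := by
  intro c hc c' hc' heq
  cases c <;> cases c' <;> simp only [fLetter, reduceCtorEq, plain.injEq] at heq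
  case plain.plain p q =>
    rw [← hs.conjugateCounts.plain_partner hc, heq, hs.conjugateCounts.plain_partner hc']
  all_goals exact heq

theorem Valid.psiLetter_range (hs : Valid a b s) (hc : CanFollow a b s c) :
    1 ≤ psiLetter b s c ∧ psiLetter b s c < a + b := by
  obtain ⟨x, y, hcxy, hx, hy⟩ := hs.canFollow_iff.1 ⟨hc, rfl⟩
  obtain ⟨hx1, hxy, hyab⟩ := hcxy.mem_range
  have hposx := hs.conjugateCounts.pos_mem_iff.2 ⟨hx1, hxy.le.trans hyab⟩
  have hposy := hs.conjugateCounts.pos_mem_iff.2 ⟨hx1.trans hxy.le, hyab⟩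
  omega

theorem psi_injOn : Set.InjOn (psi b) {w | Valid a b w} :=
  (injOn_scan fun _ hs => Valid.psiLetter_injOn hs).congr fun _ _ => (psi_eq_scan b _).symm

theorem Valid.psi_range (hw : Valid a b w) : ∀ i ∈ psi b w, 1 ≤ i ∧ i < a + b := by
  induction hw using Admissible.induction with
  | nil => simp
  | concat s c hs hc ih =>
    simp only [psi_append, scan_cons, scan_nil, List.forall_mem_append, List.forall_mem_singleton]
    exact ⟨ih, Valid.psiLetter_range hs hc⟩

end Positions

end Arrangement

/-! ### The values of the permutation -/

section Values

/-- The plain letters of a word, without their marking. -/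
def plains (w : List Letter) : List ℕ := w.filterMap fun
  | plain j => some j
  | _ => none

/-- The underlined letters of a word, without their marking. -/
def lowers (w : List Letter) : List ℕ := w.filterMap fun
  | lower j => some j
  | _ => none

/-- The overlined letters of a word, without their marking. -/
def uppers (w : List Letter) : List ℕ := w.filterMap fun
  | upper j => some j
  | _ => none

/-- The value of the permutation belonging to `psi b w` at the position of the entry `x`: the
overlined letters permute the small values, the underlined letters permute the large ones. -/
def value (b : ℕ) (w : List Letter) (x : ℕ) : ℕ :=
  if x ≤ b then wordPerm (uppers w) x else b + wordPerm (lowers w) (x - b)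

variable {a b : ℕ} {s w : List Letter} {c : Letter} {x y : ℕ}

theorem value_of_le (hx : x ≤ b) : value b w x = wordPerm (uppers w) x := if_pos hx

theorem value_add {p : ℕ} (hp : 1 ≤ p) : value b w (b + p) = b + wordPerm (lowers w) p := by
  rw [value, if_neg (by omega), Nat.add_sub_cancel_left]

theorem value_concat_plain (p : ℕ) : value b (s ++ [plain p]) = value b s := by
  funext x
  simp [value, lowers, uppers]

theorem IsBarred.value_concat (hc : IsBarred c) (h : Exchanges a b c x y) :
    value b (s ++ [c]) = value b s ∘ swap x y := by
  funext z
  rcases hc with p | p <;> obtain ⟨hp, rfl, rfl⟩ := h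
  all_goals
    simp only [value, lowers, uppers, List.filterMap_append, List.filterMap_cons,
      List.filterMap_nil, List.append_nil, wordPerm_append, wordPerm_singleton, Perm.mul_apply,
      Function.comp_apply, swap_apply_def]
    grind

namespace Valid

theorem lowers_range (hw : Valid a b w) : ∀ i ∈ lowers w, 1 ≤ i ∧ i < a := by
  intro i hi
  obtain ⟨c, hc, hci⟩ := List.mem_filterMap.1 hi
  obtain ⟨s, t, rfl⟩ := List.append_of_mem hc
  cases c <;> cases hci
  exact (hw s _ t rfl).1

theorem uppers_range (hw : Valid a b w) : ∀ i ∈ uppers w, 1 ≤ i ∧ i < b := by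
  intro i hi
  obtain ⟨c, hc, hci⟩ := List.mem_filterMap.1 hi
  obtain ⟨s, t, rfl⟩ := List.append_of_mem hc
  cases c <;> cases hci
  exact (hw s _ t rfl).1

theorem value_le_iff (hw : Valid a b w) : value b w x ≤ b ↔ x ≤ b := by
  have hupper := FixesOutside.wordPerm hw.uppers_range
  have hmaps := hupper.mapsTo (x := x)
  have hfix := hupper x
  have hpos : wordPerm (lowers w) (x - b) = wordPerm (lowers w) 0 ↔ x - b = 0 :=
    (wordPerm (lowers w)).injective.eq_iff
  rw [FixesOutside.wordPerm hw.lowers_range 0 (by omega)] at hpos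
  unfold value
  split_ifs <;> omega

theorem wordPerm_psi_comp_pos (hw : Valid a b w) : wordPerm (psi b w) ∘ pos b w = value b w := by
  induction hw using Admissible.induction with
  | nil =>
    funext x
    simp only [psi_nil, pos_nil, value, lowers, uppers, List.filterMap_nil, wordPerm_nil,
      Function.comp_id, Perm.coe_one, id_eq]
    split_ifs <;> omega
  | concat s c hs hc ih =>
    have hconcat {x y : ℕ} (hx : pos b s x = psiLetter b s c)
        (hy : pos b s y = psiLetter b s c + 1) :
        wordPerm (psi b (s ++ [c])) ∘ pos b s = value b s ∘ swap x y := by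
      have hswap := (Valid.pos_bijective hs).injective.swap_comp x y
      rw [hx, hy] at hswap
      rw [psi_append, wordPerm_append, scan_cons, scan_nil, wordPerm_singleton, Perm.coe_mul,
        Function.comp_assoc, hswap, ← Function.comp_assoc, ih]
    cases c with
    | plain p =>
      obtain ⟨-, hx, hy⟩ := (Valid.conjugateCounts hs).plain_exchanges hc
      rw [pos_concat_plain hs hc, ← Function.comp_assoc, hconcat hx hy, Function.comp_assoc,
        value_concat_plain, ← Perm.coe_mul, swap_mul_self, Perm.coe_one, Function.comp_id]
    | lower p | upper p =>
      obtain ⟨x, y, hxy, hx, hy⟩ := (Valid.canFollow_iff hs).1 ⟨hc, rfl⟩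
      rw [IsBarred.pos_concat (by constructor), IsBarred.value_concat (by constructor) hxy,
        hconcat hx hy]

theorem wordPerm_psi_pos (hw : Valid a b w) (x : ℕ) :
    wordPerm (psi b w) (pos b w x) = value b w x :=
  congrFun hw.wordPerm_psi_comp_pos x

theorem ascending_psi_iff (hw : Valid a b w) :
    Ascending (psi b w) ↔ Ascending (lowers w) ∧ Ascending (uppers w) := by
  induction hw using Admissible.induction with
  | nil => exact iff_of_true .nil ⟨.nil, .nil⟩
  | concat s c hs hc ih =>
    obtain ⟨x, y, hxy, hx, hy⟩ := (Valid.canFollow_iff hs).1 ⟨hc, rfl⟩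
    rw [psi_append, scan_cons, scan_nil, ascending_concat_iff, ih, ← hy, ← hx,
      wordPerm_psi_pos hs, wordPerm_psi_pos hs]
    cases c with
    | plain p =>
      have hlt : value b s x < value b s y := by
        obtain ⟨hp, hxb, rfl⟩ := hxy
        have hsmall := (value_le_iff hs).2 hxb.2
        have hlarge := mt (value_le_iff (x := b + p) hs).1 (by omega)
        omega
      simp [lowers, uppers, hlt]
    | lower p =>
      obtain ⟨hp, rfl, rfl⟩ := hxy
      have hlower : lowers (s ++ [lower p]) = lowers s ++ [p] := by simp [lowers]
      have hupper : uppers (s ++ [lower p]) = uppers s := by simp [uppers]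
      rw [hlower, hupper, ascending_concat_iff, add_assoc, value_add hp.1,
        value_add (Nat.le_add_left 1 p), add_lt_add_iff_left, and_right_comm]
    | upper p =>
      obtain ⟨hp, rfl, rfl⟩ := hxy
      have hlower : lowers (s ++ [upper x]) = lowers s := by simp [lowers]
      have hupper : uppers (s ++ [upper x]) = uppers s ++ [x] := by simp [uppers]
      rw [hlower, hupper, ascending_concat_iff, value_of_le hp.2.le,
        value_of_le (x := x + 1) hp.2, and_assoc]

theorem lt_of_value_lt (hw : Valid a b w) (hpos : pos b w x < pos b w y)
    (hvalue : value b w x < value b w y) : x < y := by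
  by_contra! hle
  rcases hle.eq_or_lt with rfl | hlt
  · exact hpos.false
  · by_cases hclass : x ≤ b ∨ b < y
    · exact hpos.not_gt (hw.conjugateCounts.pos_lt_pos hlt hclass)
    · have hx := mt (value_le_iff (x := x) hw).1 (by omega)
      have hy := (value_le_iff (x := y) hw).2 (by omega)
      omega

end Valid

theorem exists_valid_of_ascending {r : List ℕ} (hr : ∀ i ∈ r, 1 ≤ i ∧ i < a + b)
    (hasc : Ascending r) : ∃ w, Valid a b w ∧ psi b w = r := by
  induction hasc using Admissible.induction with
  | nil => exact ⟨[], .nil, rfl⟩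
  | concat r i _ hlt ih =>
    simp only [List.forall_mem_append, List.forall_mem_singleton] at hr
    obtain ⟨s, hs, rfl⟩ := ih hr.1
    obtain ⟨x, hx⟩ := hs.pos_bijective.surjective i
    obtain ⟨y, hy⟩ := hs.pos_bijective.surjective (i + 1)
    rw [← hy, ← hx, hs.wordPerm_psi_pos, hs.wordPerm_psi_pos] at hlt
    have hxy : x < y := hs.lt_of_value_lt (by omega) hlt
    have hx' := (hs.conjugateCounts.pos_mem_iff (x := x)).1 (by omega)
    have hy' := (hs.conjugateCounts.pos_mem_iff (x := y)).1 (by omega)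
    obtain ⟨c, hc⟩ := hs.conjugateCounts.exists_exchanges hx'.1 hxy hy'.2 (hx ▸ hy)
    obtain ⟨hc, rfl⟩ := hs.canFollow_iff.2 ⟨x, y, hc, hx, hy⟩
    exact ⟨s ++ [c], valid_concat_iff.2 ⟨hs, hc⟩, by simp [psi_append]⟩

end Values

/-! ### The vertex set -/

section Vertices

/-- Each of the plain letters `1, …, a` has multiplicity `b` in the word. -/
def IsFull (a b : ℕ) (w : List Letter) : Prop := ∀ j, 1 ≤ j → j ≤ a → N j w = b

variable {a b : ℕ} {w : List Letter}

section Inflation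

variable {α : Perm (Fin a)} {β : Perm (Fin b)}

theorem IsFull.pos_add (hw : IsFull a b w) {j : ℕ} (hj : 1 ≤ j ∧ j ≤ a) :
    pos b w (b + j) = j := by
  rw [Inflation21.pos_add hj.1, hw j hj.1 hj.2, Nat.add_sub_cancel_left]

theorem IsFull.pos_of_le (hw : IsFull a b w) (h : ConjugateCounts a b w) {k : ℕ}
    (hk : 1 ≤ k ∧ k ≤ b) : pos b w k = a + k := by
  rw [Inflation21.pos_of_le hk.2]
  have hle := h.f_le k
  rcases Nat.eq_zero_or_pos a with rfl | ha
  · omega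
  · have hgalois := h.galois a k ha le_rfl hk.1 hk.2
    have hN := hw a ha le_rfl
    omega

theorem Valid.isFull_of_wordPerm_psi (hw : Valid a b w)
    (h : ∀ i : Fin b, wordPerm (psi b w) (a + i + 1) ≤ b) : IsFull a b w := by
  intro j hj hja
  by_contra hne
  have hanti := hw.conjugateCounts.anti j a hj hja
  have hlt := (hw.conjugateCounts.le j).lt_of_ne hne
  have hpos : pos b w (b + a) = a + (b - N a w - 1) + 1 := by
    rw [pos_add (by omega)]
    omega
  have hle := h ⟨b - N a w - 1, by omega⟩
  rw [← hpos, hw.wordPerm_psi_pos, hw.value_le_iff] at hle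
  omega

theorem Valid.wordPerm_psi_eq_iff_of_isFull (hw : Valid a b w) (hfull : IsFull a b w) :
    natPerm (a + b) (inflation21 α β) = wordPerm (psi b w) ↔
      natPerm a α = wordPerm (lowers w) ∧ natPerm b β = wordPerm (uppers w) := by
  rw [natPerm_eq_iff _ (.wordPerm hw.psi_range), natPerm_eq_iff _ (.wordPerm hw.lowers_range),
    natPerm_eq_iff _ (.wordPerm hw.uppers_range), Fin.forall_fin_add]
  refine and_congr (forall_congr' fun i => ?_) (forall_congr' fun i => ?_)
  · have hpos := hfull.pos_add (j := i + 1) (by omega)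
    have hvalue := hw.wordPerm_psi_pos (b + (i + 1))
    rw [hpos, value_add (Nat.le_add_left 1 i)] at hvalue
    rw [inflation21_left, Fin.val_castAdd, hvalue]
    omega
  · have hpos := hfull.pos_of_le hw.conjugateCounts (k := i + 1) (by omega)
    have hvalue := hw.wordPerm_psi_pos (i + 1)
    rw [hpos, value_of_le (by omega), ← add_assoc] at hvalue
    rw [inflation21_right, Fin.val_natAdd, hvalue]

theorem Valid.wordPerm_psi_eq_iff (hw : Valid a b w) :
    wordPerm (psi b w) = natPerm (a + b) (inflation21 α β) ↔
      IsFull a b w ∧ wordPerm (lowers w) = natPerm a α ∧ wordPerm (uppers w) = natPerm b β := by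
  simp only [eq_comm (b := natPerm _ _)]
  constructor
  · intro heq
    have hfull : IsFull a b w := hw.isFull_of_wordPerm_psi fun i => by
      rw [← heq, ← Fin.val_natAdd, natPerm_apply, inflation21_right]
      exact (β i).isLt
    exact ⟨hfull, (hw.wordPerm_psi_eq_iff_of_isFull hfull).1 heq⟩
  · rintro ⟨hfull, heq⟩
    exact (hw.wordPerm_psi_eq_iff_of_isFull hfull).2 heq

end Inflation

theorem isShuffle_iff {x u v : List ℕ} :
    IsShuffle (x.map plain) (u.map lower) (v.map upper) w ↔
      plains w = x ∧ lowers w = u ∧ uppers w = v := by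
  constructor
  · intro h
    generalize hX : x.map plain = X at h
    generalize hU : u.map lower = U at h
    generalize hV : v.map upper = V at h
    induction h generalizing x u v with
    | nil => simp_all [plains, lowers, uppers]
    | fst c _ ih =>
      obtain ⟨j, x, rfl, rfl, hX'⟩ := List.map_eq_cons_iff.1 hX
      obtain ⟨hx, hu, hv⟩ := ih hX' hU hV
      exact ⟨congrArg (j :: ·) hx, hu, hv⟩
    | snd c _ ih =>
      obtain ⟨j, u, rfl, rfl, hU'⟩ := List.map_eq_cons_iff.1 hU
      obtain ⟨hx, hu, hv⟩ := ih hX hU' hV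
      exact ⟨hx, congrArg (j :: ·) hu, hv⟩
    | trd c _ ih =>
      obtain ⟨j, v, rfl, rfl, hV'⟩ := List.map_eq_cons_iff.1 hV
      obtain ⟨hx, hu, hv⟩ := ih hX hU hV'
      exact ⟨hx, hu, congrArg (j :: ·) hv⟩
  · rintro ⟨rfl, rfl, rfl⟩
    induction w with
    | nil => exact .nil
    | cons c w ih =>
      cases c with
      | plain j => exact .fst (plain j) ih
      | lower j => exact .snd (lower j) ih
      | upper j => exact .trd (upper j) ih

theorem count_plains (j : ℕ) (w : List Letter) : (plains w).count j = N j w := by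
  induction w with
  | nil => rfl
  | cons c w ih =>
    rw [← List.singleton_append, N_append, ← ih]
    cases c <;> simp [plains, List.count_cons, Nat.add_comm]

theorem coe_eq_sum_replicate_iff {x : List ℕ} :
    (x : Multiset ℕ) = ∑ i ∈ Finset.Icc 1 a, Multiset.replicate b i ↔
      ∀ j, x.count j = if 1 ≤ j ∧ j ≤ a then b else 0 := by
  rw [Multiset.ext]
  refine forall_congr' fun j => ?_
  rw [Multiset.coe_count, Multiset.count_sum']
  simp [Multiset.count_replicate]

theorem Valid.plains_mem_ballot_iff (hw : Valid a b w) :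
    plains w ∈ ballot a b ↔ IsFull a b w := by
  have hrange := hw.conjugateCounts.range
  rw [ballot, Set.mem_ofPred_eq, coe_eq_sum_replicate_iff]
  simp only [count_plains]
  constructor
  · rintro ⟨-, h⟩ j hj hja
    rw [h, if_pos ⟨hj, hja⟩]
  · refine fun h => ⟨⟨fun j hj => (hrange j ?_).1, fun j k hj hjk m _ => ?_⟩, fun j => ?_⟩
    · rw [← count_plains]
      exact (List.count_pos_iff.2 hj).ne'
    · obtain ⟨l, ⟨t, rfl⟩, hl⟩ := List.prefix_filterMap_iff.1 (List.take_prefix m (plains w))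
      rw [hl, ← plains, count_plains, count_plains]
      exact (Valid.conjugateCounts hw.left).anti j k hj hjk.le
    · split_ifs with hj
      · exact h j hj.1 hj.2
      · exact not_not.1 (mt (hrange j) hj)

theorem canFollow_plain_of_ballot {s t : List Letter} {j : ℕ}
    (h : plains (s ++ plain j :: t) ∈ ballot a b) : CanFollow a b s (plain j) := by
  obtain ⟨⟨-, hballot⟩, hcount⟩ := h
  have hsplit : plains (s ++ plain j :: t) = plains (s ++ [plain j]) ++ plains t := by
    simp [plains]
  have hj := coe_eq_sum_replicate_iff.1 hcount j
  rw [hsplit, List.count_append, count_plains, N_concat_plain, if_pos rfl] at hj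
  have hja : 1 ≤ j ∧ j ≤ a := by
    by_contra hja
    rw [if_neg hja] at hj
    omega
  rw [if_pos hja] at hj
  refine ⟨hja, by omega, fun k hk hkj => ?_⟩
  have hle := hballot k j hk hkj (plains (s ++ [plain j])).length
  rw [hsplit, List.take_left, count_plains, count_plains, N_concat_plain, N_concat_plain,
    if_pos rfl, if_neg hkj.ne'] at hle
  exact hle (by rw [List.length_append]; exact Nat.le_add_right _ _)

theorem f_take (b : ℕ) (w : List Letter) (i : ℕ) : (f b w).take i = f b (w.take i) := by
  rw [f_eq_scan, f_eq_scan, take_scan]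

theorem mem_restrictedShuffle_iff {x u v : List ℕ} : w ∈ restrictedShuffle b x u v ↔
    (plains w = x ∧ lowers w = u ∧ uppers w = v) ∧
      (∀ s j t, w = s ++ lower j :: t → N j s = N (j + 1) s) ∧
      ∀ s j t, w = s ++ upper j :: t → N j (f b s) = N (j + 1) (f b s) := by
  have hsplit (c : ℕ → Letter) (P : List Letter → ℕ → Prop) :
      (∀ i j, w[i]? = some (c j) → P (w.take i) j) ↔ ∀ s j t, w = s ++ c j :: t → P s j := by
    constructor
    · rintro h s j t rfl
      simpa using h s.length j (by simp)
    · intro h i j hij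
      obtain ⟨hi, hget⟩ := List.getElem?_eq_some_iff.1 hij
      exact h _ j (w.drop (i + 1)) (by rw [← hget]; simp)
  rw [restrictedShuffle, Set.mem_ofPred_eq, isShuffle_iff]
  simp only [f_take]
  rw [hsplit lower fun s j => N j s = N (j + 1) s,
    hsplit upper fun s j => N j (f b s) = N (j + 1) (f b s)]

section VertexSet

variable {α : Perm (Fin a)} {β : Perm (Fin b)}

theorem mem_vertexSet_iff :
    w ∈ vertexSet α β ↔ Valid a b w ∧ IsFull a b w ∧
      lowers w ∈ reducedWords α ∧ uppers w ∈ reducedWords β := by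
  simp only [vertexSet, Set.mem_iUnion, exists_prop, mem_restrictedShuffle_iff]
  constructor
  · rintro ⟨x, hx, u, hu, v, hv, ⟨rfl, rfl, rfl⟩, hlower, hupper⟩
    have hw : Valid a b w := by
      rintro s (j | j | j) t rfl
      · exact canFollow_plain_of_ballot hx
      · exact ⟨(mem_reducedWords_iff.1 hu).1 j (by simp [lowers]), hlower s j t rfl⟩
      · exact ⟨(mem_reducedWords_iff.1 hv).1 j (by simp [uppers]), hupper s j t rfl⟩
    exact ⟨hw, hw.plains_mem_ballot_iff.1 hx, hu, hv⟩
  · rintro ⟨hw, hfull, hu, hv⟩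
    exact ⟨_, hw.plains_mem_ballot_iff.2 hfull, _, hu, _, hv, ⟨rfl, rfl, rfl⟩,
      fun s j t h => (hw s _ t h).2, fun s j t h => (hw s _ t h).2⟩

theorem mem_vertexSet_iff_psi_mem :
    w ∈ vertexSet α β ↔ Valid a b w ∧ psi b w ∈ reducedWords (inflation21 α β) := by
  rw [mem_vertexSet_iff]
  refine and_congr_right fun hw => ?_
  rw [mem_reducedWords_iff, mem_reducedWords_iff, mem_reducedWords_iff,
    hw.wordPerm_psi_eq_iff, hw.ascending_psi_iff]
  have hpsi := hw.psi_range
  have hlowers := hw.lowers_range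
  have huppers := hw.uppers_range
  tauto

end VertexSet

theorem psi_bijOn (α : Perm (Fin a)) (β : Perm (Fin b)) :
    Set.BijOn (psi b) (vertexSet α β) (reducedWords (inflation21 α β)) := by
  refine ⟨fun w hw => (mem_vertexSet_iff_psi_mem.1 hw).2,
    psi_injOn.mono fun w hw => (mem_vertexSet_iff.1 hw).1, fun r hr => ?_⟩
  obtain ⟨hrange, -, hasc⟩ := mem_reducedWords_iff.1 hr
  obtain ⟨w, hw, rfl⟩ := exists_valid_of_ascending hrange hasc
  exact ⟨w, mem_vertexSet_iff_psi_mem.2 ⟨hw, hr⟩, rfl⟩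

end Vertices

/-- The word `w'` arises from `w` by replacing the letters `p` that follow the prefix `s` by the
letters `q`. -/
def ReplacesAfter {A : Type*} (s p q w w' : List A) : Prop :=
  ∃ t, w = s ++ p ++ t ∧ w' = s ++ q ++ t

/-- Both `q` and `q'` may follow `s`, and they can be exchanged whatever comes afterwards. -/
structure Interchangeable (a b : ℕ) (s q q' : List Letter) : Prop where
  left : Valid a b (s ++ q)
  right : Valid a b (s ++ q')
  counts_eq : counts b (s ++ q) = counts b (s ++ q')

/-- A rule, such as those of `f` and `psi`, by which a letter and the plain letters before it
determine the letter of the image word and are recovered from it. -/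
structure IsEncoding (a b : ℕ) {B : Type*} (g : List Letter → Letter → B) : Prop where
  congr : ∀ s s' c, counts b s = counts b s' → g s c = g s' c
  injOn : ∀ s, Valid a b s → Set.InjOn (g s) {c | CanFollow a b s c}

theorem isEncoding_fLetter (a b : ℕ) : IsEncoding a b (fLetter b) :=
  ⟨fun _ _ _ => fLetter_congr, fun _ => Valid.fLetter_injOn⟩

theorem isEncoding_psiLetter (a b : ℕ) : IsEncoding a b (psiLetter b) :=
  ⟨fun _ _ _ => psiLetter_congr, fun _ => Valid.psiLetter_injOn⟩

section Moves

variable {a b : ℕ} {s q q' w w' : List Letter}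

theorem Valid.canFollow {c : Letter} {t : List Letter} (h : Valid a b (s ++ c :: t)) :
    CanFollow a b s c := h s c t rfl

namespace IsEncoding

variable {B : Type*} {g : List Letter → Letter → B}

theorem exists_next_letters (hg : IsEncoding a b g) (hw : Valid a b w) (hw' : Valid a b w')
    {R T T' : List B} {i i' : B} (h : scan g [] w = R ++ i :: T)
    (h' : scan g [] w' = R ++ i' :: T') :
    ∃ s c c', Valid a b s ∧ scan g [] s = R ∧ (CanFollow a b s c ∧ g s c = i) ∧
      (CanFollow a b s c' ∧ g s c' = i') := by
  obtain ⟨s, t, rfl, hs, ht⟩ := exists_of_scan_eq_append h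
  obtain ⟨s', t', rfl, hs', ht'⟩ := exists_of_scan_eq_append h'
  obtain rfl := injOn_scan hg.injOn hw.left hw'.left (hs.trans hs'.symm)
  obtain ⟨c, t, rfl⟩ := List.exists_cons_of_ne_nil (l := t) (by rintro rfl; simp at ht)
  obtain ⟨c', t', rfl⟩ := List.exists_cons_of_ne_nil (l := t') (by rintro rfl; simp at ht')
  rw [scan_cons, List.cons.injEq, List.nil_append] at ht ht'
  exact ⟨s, c, c', hw.left, hs, ⟨hw.canFollow, ht.1⟩, ⟨hw'.canFollow, ht'.1⟩⟩

theorem replacesAfter_iff (hg : IsEncoding a b g) (h : Interchangeable a b s q q')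
    (hw : Valid a b w) (hw' : Valid a b w') :
    ReplacesAfter (scan g [] s) (scan g s q) (scan g s q') (scan g [] w) (scan g [] w') ↔
      ReplacesAfter s q q' w w' := by
  have hscan (q t) : scan g [] (s ++ q ++ t) = scan g [] s ++ scan g s q ++ scan g (s ++ q) t := by
    simp only [scan_append, List.nil_append]
  constructor
  · rintro ⟨T, hT, hT'⟩
    obtain ⟨v, t, rfl, hv, rfl⟩ := exists_of_scan_eq_append hT
    obtain rfl := injOn_scan hg.injOn hw.left h.left (by rw [hv, scan_append, List.nil_append])
    refine ⟨t, rfl, injOn_scan hg.injOn hw' (hw.append_congr h.counts_eq h.right) ?_⟩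
    rw [hT', hscan, List.nil_append, scan_congr hg.congr h.counts_eq]
  · rintro ⟨t, rfl, rfl⟩
    exact ⟨scan g (s ++ q) t, hscan q t, by rw [hscan, scan_congr hg.congr h.counts_eq]⟩

end IsEncoding

theorem Interchangeable.replacesAfter_psi_iff (h : Interchangeable a b s q q') (hw : Valid a b w)
    (hw' : Valid a b w') :
    ReplacesAfter (psi b s) (scan (psiLetter b) s q) (scan (psiLetter b) s q') (psi b w)
      (psi b w') ↔ ReplacesAfter s q q' w w' := by
  simpa only [psi_eq_scan] using (isEncoding_psiLetter a b).replacesAfter_iff h hw hw'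

theorem Interchangeable.replacesAfter_f_iff (h : Interchangeable a b s q q') (hw : Valid a b w)
    (hw' : Valid a b w') :
    ReplacesAfter (f b s) (scan (fLetter b) s q) (scan (fLetter b) s q') (f b w) (f b w') ↔
      ReplacesAfter s q q' w w' := by
  simpa only [f_eq_scan] using (isEncoding_fLetter a b).replacesAfter_iff h hw hw'

theorem exists_next_letters_of_psi (hw : Valid a b w) (hw' : Valid a b w') {R T T' : List ℕ}
    {i i' : ℕ} (h : psi b w = R ++ i :: T) (h' : psi b w' = R ++ i' :: T') :
    ∃ s c c', Valid a b s ∧ psi b s = R ∧ (CanFollow a b s c ∧ psiLetter b s c = i) ∧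
      (CanFollow a b s c' ∧ psiLetter b s c' = i') := by
  simp only [psi_eq_scan] at h h' ⊢
  exact (isEncoding_psiLetter a b).exists_next_letters hw hw' h h'

theorem exists_next_letters_of_f (hw : Valid a b w) (hw' : Valid a b w')
    {R T T' : List Letter} {p k : ℕ} (h : f b w = R ++ upper p :: T)
    (h' : f b w' = R ++ plain k :: T') :
    ∃ s j, Valid a b s ∧ f b s = R ∧ CanFollow a b s (upper p) ∧ CanFollow a b s (plain j) ∧
      b - N j s = k := by
  rw [f_eq_scan] at h h'
  obtain ⟨s, c, c', hs, rfl, ⟨hc, hcp⟩, ⟨hc', hck⟩⟩ :=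
    (isEncoding_fLetter a b).exists_next_letters hw hw' h h'
  cases c <;> simp only [fLetter, reduceCtorEq, upper.injEq] at hcp
  cases c' <;> simp only [fLetter, reduceCtorEq, plain.injEq] at hck
  exact ⟨s, _, hs, f_eq_scan b s, hcp ▸ hc, hc', hck⟩

/-! ### Commutation moves -/

theorem Far.symm {p q : ℕ} (h : Far p q) : Far q p := Or.symm h

namespace Valid

variable {c c' : Letter} {x y x' y' z i i' p : ℕ}

theorem far_iff (hs : Valid a b s) (hx : pos b s x = i) (hy : pos b s y = i + 1)
    (hx' : pos b s x' = i') (hy' : pos b s y' = i' + 1) :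
    Far i i' ↔ (x ≠ x' ∧ x ≠ y') ∧ y ≠ x' ∧ y ≠ y' := by
  have hinj {u v : ℕ} : u ≠ v ↔ pos b s u ≠ pos b s v := hs.pos_bijective.injective.ne_iff.symm
  rw [hinj (u := x), hinj (u := x), hinj (u := y), hinj (u := y), hx, hy, hx', hy', Far]
  omega

theorem pos_concat_plain_of_exchanges (hs : Valid a b s) (hp : Exchanges a b (plain p) x y)
    (hpos : pos b s y = pos b s x + 1) : pos b (s ++ [plain p]) = pos b s ∘ swap x y := by
  obtain ⟨hfol, rfl⟩ := hs.conjugateCounts.canFollow_plain hp hpos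
  obtain ⟨-, -, rfl⟩ := hp
  exact pos_concat_plain hs hfol

theorem pos_concat_of_ne (hs : Valid a b s) (hc : Exchanges a b c x y)
    (hpos : pos b s y = pos b s x + 1) (hzx : z ≠ x) (hzy : z ≠ y) :
    pos b (s ++ [c]) z = pos b s z := by
  cases c with
  | plain p =>
    rw [hs.pos_concat_plain_of_exchanges hc hpos, Function.comp_apply,
      swap_apply_of_ne_of_ne hzx hzy]
  | lower p => rw [(IsBarred.lower p).pos_concat]
  | upper p => rw [(IsBarred.upper p).pos_concat]

theorem canFollow_concat_of_far (hs : Valid a b s) (hc : CanFollow a b s c)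
    (hc' : CanFollow a b s c') (hfar : Far (psiLetter b s c) (psiLetter b s c')) :
    CanFollow a b (s ++ [c]) c' ∧ psiLetter b (s ++ [c]) c' = psiLetter b s c' := by
  obtain ⟨x, y, hcxy, hx, hy⟩ := hs.canFollow_iff.1 ⟨hc, rfl⟩
  obtain ⟨x', y', hcxy', hx', hy'⟩ := hs.canFollow_iff.1 ⟨hc', rfl⟩
  obtain ⟨⟨hxx, hxy⟩, hyx, hyy⟩ := (hs.far_iff hx hy hx' hy').1 hfar
  have hstay {z : ℕ} := hs.pos_concat_of_ne (z := z) hcxy (hx ▸ hy)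
  refine (canFollow_iff (valid_concat_iff.2 ⟨hs, hc⟩)).2 ⟨x', y', hcxy', ?_, ?_⟩
  · rw [hstay hxx.symm hyx.symm, hx']
  · rw [hstay hxy.symm hyy.symm, hy']

theorem interchangeable_of_far (hs : Valid a b s) (hc : CanFollow a b s c)
    (hc' : CanFollow a b s c') (hfar : Far (psiLetter b s c) (psiLetter b s c')) :
    Interchangeable a b s [c, c'] [c', c] ∧
      scan (psiLetter b) s [c, c'] = [psiLetter b s c, psiLetter b s c'] ∧
      scan (psiLetter b) s [c', c] = [psiLetter b s c', psiLetter b s c] := by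
  obtain ⟨h, hpsi⟩ := hs.canFollow_concat_of_far hc hc' hfar
  obtain ⟨h', hpsi'⟩ := hs.canFollow_concat_of_far hc' hc hfar.symm
  have hleft : Valid a b (s ++ [c, c']) := by
    simpa using valid_concat_iff.2 ⟨valid_concat_iff.2 ⟨hs, hc⟩, h⟩
  have hright : Valid a b (s ++ [c', c]) := by
    simpa using valid_concat_iff.2 ⟨valid_concat_iff.2 ⟨hs, hc'⟩, h'⟩
  have hperm : (s ++ [c, c']).Perm (s ++ [c', c]) := .append_left s (.swap c' c [])
  exact ⟨⟨hleft, hright, hleft.counts_eq hright fun j => hperm.count_eq _⟩, by simp [hpsi],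
    by simp [hpsi']⟩

theorem far_lower_lower (hs : Valid a b s) {p q : ℕ} (hp : CanFollow a b s (lower p))
    (hq : CanFollow a b s (lower q)) :
    Far (psiLetter b s (lower p)) (psiLetter b s (lower q)) ↔ Far p q := by
  obtain ⟨_, _, ⟨-, rfl, rfl⟩, hx, hy⟩ := hs.canFollow_iff.1 ⟨hp, rfl⟩
  obtain ⟨_, _, ⟨-, rfl, rfl⟩, hx', hy'⟩ := hs.canFollow_iff.1 ⟨hq, rfl⟩
  rw [hs.far_iff hx hy hx' hy', Far]
  omega

theorem far_upper_upper (hs : Valid a b s) {p q : ℕ} (hp : CanFollow a b s (upper p))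
    (hq : CanFollow a b s (upper q)) :
    Far (psiLetter b s (upper p)) (psiLetter b s (upper q)) ↔ Far p q := by
  obtain ⟨p, _, ⟨-, rfl, rfl⟩, hx, hy⟩ := hs.canFollow_iff.1 ⟨hp, rfl⟩
  obtain ⟨q, _, ⟨-, rfl, rfl⟩, hx', hy'⟩ := hs.canFollow_iff.1 ⟨hq, rfl⟩
  rw [hs.far_iff hx hy hx' hy', Far]
  omega

theorem far_lower_upper (hs : Valid a b s) {p q : ℕ} (hp : CanFollow a b s (lower p))
    (hq : CanFollow a b s (upper q)) :
    Far (psiLetter b s (lower p)) (psiLetter b s (upper q)) := by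
  obtain ⟨_, _, ⟨hpa, rfl, rfl⟩, hx, hy⟩ := hs.canFollow_iff.1 ⟨hp, rfl⟩
  obtain ⟨q, _, ⟨hqb, rfl, rfl⟩, hx', hy'⟩ := hs.canFollow_iff.1 ⟨hq, rfl⟩
  rw [hs.far_iff hx hy hx' hy']
  omega

theorem far_lower_plain (hs : Valid a b s) {p q : ℕ} (hp : CanFollow a b s (lower p))
    (hq : CanFollow a b s (plain q)) :
    Far (psiLetter b s (lower p)) (psiLetter b s (plain q)) ↔ Far p q ∨ q < p := by
  obtain ⟨_, _, ⟨hpa, rfl, rfl⟩, hx, hy⟩ := hs.canFollow_iff.1 ⟨hp, rfl⟩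
  obtain ⟨_, _, ⟨hqa, hqb, rfl⟩, hx', hy'⟩ := hs.canFollow_iff.1 ⟨hq, rfl⟩
  rw [hs.far_iff hx hy hx' hy', Far]
  omega

theorem far_upper_plain (hs : Valid a b s) {p q : ℕ} (hp : CanFollow a b s (upper p))
    (hq : CanFollow a b s (plain q)) :
    Far (psiLetter b s (upper p)) (psiLetter b s (plain q)) ↔
      Far p (b - N q s) ∨ b - N q s < p := by
  obtain ⟨p, _, ⟨hpb, rfl, rfl⟩, hx, hy⟩ := hs.canFollow_iff.1 ⟨hp, rfl⟩
  obtain ⟨⟨hqa, -⟩, hx', hy'⟩ := hs.conjugateCounts.plain_exchanges hq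
  rw [hs.far_iff hx hy hx' hy', Far]
  omega

theorem far_plain_plain (hs : Valid a b s) {p q : ℕ} (hp : CanFollow a b s (plain p))
    (hq : CanFollow a b s (plain q)) :
    Far (psiLetter b s (plain p)) (psiLetter b s (plain q)) ↔ p ≠ q := by
  refine ⟨fun h hpq => by subst hpq; simp [Far] at h, fun hne => ?_⟩
  obtain ⟨_, _, ⟨hpa, hpb, rfl⟩, hx, hy⟩ := hs.canFollow_iff.1 ⟨hp, rfl⟩
  obtain ⟨_, _, ⟨hqa, hqb, rfl⟩, hx', hy'⟩ := hs.canFollow_iff.1 ⟨hq, rfl⟩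
  have hpsi := hs.psiLetter_injOn.ne hp hq (mt plain.inj hne)
  rw [hs.far_iff hx hy hx' hy']
  refine ⟨⟨fun h => hpsi (by rw [← hx, ← hx', h]), ?_⟩, ?_⟩ <;> omega

end Valid

theorem ReplacesAfter.head_canFollow {c c' : Letter} (h : ReplacesAfter s (c :: q) (c' :: q') w w')
    (hw : Valid a b w) (hw' : Valid a b w') :
    Valid a b s ∧ CanFollow a b s c ∧ CanFollow a b s c' := by
  obtain ⟨t, rfl, rfl⟩ := h
  exact ⟨hw.left.left, Valid.canFollow hw.left, Valid.canFollow hw'.left⟩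

/-- The word `w'` arises from `w` by exchanging two consecutive letters that act on disjoint pairs
of neighbouring positions. -/
def FarExchange (a b : ℕ) (w w' : List Letter) : Prop :=
  ∃ s c c', (Valid a b s ∧ CanFollow a b s c ∧ CanFollow a b s c') ∧
    Far (psiLetter b s c) (psiLetter b s c') ∧ ReplacesAfter s [c, c'] [c', c] w w'

theorem commMove_psi_iff (hw : Valid a b w) (hw' : Valid a b w') :
    CommMove (psi b w) (psi b w') ↔ FarExchange a b w w' := by
  constructor
  · rintro ⟨R, T, i, i', hfar, h, h'⟩
    obtain ⟨s, c, c', hs, rfl, ⟨hc, rfl⟩, ⟨hc', rfl⟩⟩ :=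
      exists_next_letters_of_psi hw hw' (by simpa using h) (by simpa using h')
    obtain ⟨hi, hpsi, hpsi'⟩ := hs.interchangeable_of_far hc hc' hfar
    exact ⟨s, c, c', ⟨hs, hc, hc'⟩, hfar,
      (hi.replacesAfter_psi_iff hw hw').1 ⟨T, hpsi ▸ h, hpsi' ▸ h'⟩⟩
  · rintro ⟨s, c, c', ⟨hs, hc, hc'⟩, hfar, h⟩
    obtain ⟨hi, hpsi, hpsi'⟩ := hs.interchangeable_of_far hc hc' hfar
    obtain ⟨T, hT, hT'⟩ := (hi.replacesAfter_psi_iff hw hw').2 h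
    exact ⟨psi b s, T, _, _, hfar, hpsi ▸ hT, hpsi' ▸ hT'⟩

theorem HComm.farExchange (h : HComm b w w') (hw : Valid a b w) (hw' : Valid a b w') :
    FarExchange a b w w' := by
  cases h with
  | lowerLower p q hpq h =>
    obtain ⟨s, h⟩ := h
    obtain ⟨hs, hp, hq⟩ := ReplacesAfter.head_canFollow h hw hw'
    exact ⟨s, _, _, ⟨hs, hp, hq⟩, (hs.far_lower_lower hp hq).2 hpq, h⟩
  | upperUpper p q hpq h =>
    obtain ⟨s, h⟩ := h
    obtain ⟨hs, hp, hq⟩ := ReplacesAfter.head_canFollow h hw hw'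
    exact ⟨s, _, _, ⟨hs, hp, hq⟩, (hs.far_upper_upper hp hq).2 hpq, h⟩
  | plainPlain s t p q hpq h h' =>
    have h : ReplacesAfter s [plain p, plain q] [plain q, plain p] w w' := ⟨t, h, h'⟩
    obtain ⟨hs, hp, hq⟩ := h.head_canFollow hw hw'
    exact ⟨s, _, _, ⟨hs, hp, hq⟩, (hs.far_plain_plain hp hq).2 (by omega), h⟩
  | lowerUpper p q h =>
    obtain ⟨s, h⟩ := h
    obtain ⟨hs, hp, hq⟩ := ReplacesAfter.head_canFollow h hw hw'
    exact ⟨s, _, _, ⟨hs, hp, hq⟩, hs.far_lower_upper hp hq, h⟩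
  | lowerPlain p q hpq h =>
    obtain ⟨s, h⟩ := h
    obtain ⟨hs, hp, hq⟩ := ReplacesAfter.head_canFollow h hw hw'
    exact ⟨s, _, _, ⟨hs, hp, hq⟩, (hs.far_lower_plain hp hq).2 hpq, h⟩
  | upperPlain p q hpq h =>
    obtain ⟨R, T, h, h'⟩ := h
    obtain ⟨s, j, hs, rfl, hp, hj, rfl⟩ :=
      exists_next_letters_of_f hw hw' (by simpa using h) (by simpa using h')
    have hfar := (hs.far_upper_plain hp hj).2 hpq
    obtain ⟨hi, -⟩ := hs.interchangeable_of_far hp hj hfar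
    exact ⟨s, _, _, ⟨hs, hp, hj⟩, hfar, (hi.replacesAfter_f_iff hw hw').1
      ⟨T, by simpa [fLetter] using h, by simpa [fLetter] using h'⟩⟩

theorem ReplacesAfter.hComm_upper_plain {p j : ℕ}
    (h : ReplacesAfter s [upper p, plain j] [plain j, upper p] w w') (hw : Valid a b w)
    (hw' : Valid a b w') (hfar : Far (psiLetter b s (upper p)) (psiLetter b s (plain j))) :
    HComm b w w' := by
  obtain ⟨hs, hp, hj⟩ := h.head_canFollow hw hw'
  obtain ⟨hi, -⟩ := hs.interchangeable_of_far hp hj hfar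
  obtain ⟨T, hT, hT'⟩ := (hi.replacesAfter_f_iff hw hw').2 h
  exact .upperPlain p (b - N j s) ((hs.far_upper_plain hp hj).1 hfar)
    ⟨f b s, T, by simpa [fLetter] using hT, by simpa [fLetter] using hT'⟩

theorem ReplacesAfter.symm (h : ReplacesAfter s q q' w w') : ReplacesAfter s q' q w' w := by
  obtain ⟨t, h, h'⟩ := h
  exact ⟨t, h', h⟩

theorem FarExchange.hComm (h : FarExchange a b w w') (hw : Valid a b w) (hw' : Valid a b w') :
    HComm b w w' ∨ HComm b w' w := by
  obtain ⟨s, c, c', ⟨hs, hc, hc'⟩, hfar, h⟩ := h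
  match c, c' with
  | lower p, lower q => exact .inl (.lowerLower p q ((hs.far_lower_lower hc hc').1 hfar) ⟨s, h⟩)
  | upper p, upper q => exact .inl (.upperUpper p q ((hs.far_upper_upper hc hc').1 hfar) ⟨s, h⟩)
  | lower p, upper q => exact .inl (.lowerUpper p q ⟨s, h⟩)
  | upper p, lower q => exact .inr (.lowerUpper q p ⟨s, h.symm⟩)
  | lower p, plain q => exact .inl (.lowerPlain p q ((hs.far_lower_plain hc hc').1 hfar) ⟨s, h⟩)
  | plain p, lower q =>
    exact .inr (.lowerPlain q p ((hs.far_lower_plain hc' hc).1 hfar.symm) ⟨s, h.symm⟩)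
  | upper p, plain q => exact .inl (h.hComm_upper_plain hw hw' hfar)
  | plain p, upper q => exact .inr (h.symm.hComm_upper_plain hw' hw hfar.symm)
  | plain p, plain q =>
    obtain ⟨t, h, h'⟩ := h
    rcases ((hs.far_plain_plain hc hc').1 hfar).lt_or_gt with hpq | hqp
    · exact .inr (.plainPlain s t q p (.inl hpq) h' h)
    · exact .inl (.plainPlain s t p q (.inl hqp) h h')

/-! ### Braid moves -/

/-- The letters `q` may follow `s`, and `psi` maps them to `r`. -/
def Reads (a b : ℕ) (s q : List Letter) (r : List ℕ) : Prop :=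
  Valid a b (s ++ q) ∧ scan (psiLetter b) s q = r

namespace Reads

variable {r : List ℕ} {c : Letter} {x y i : ℕ}

theorem nil (hs : Valid a b s) : Reads a b s [] [] := ⟨by simpa using hs, rfl⟩

theorem concat (h : Reads a b s q r) (hc : CanFollow a b (s ++ q) c ∧ psiLetter b (s ++ q) c = i) :
    Reads a b s (q ++ [c]) (r ++ [i]) := by
  refine ⟨?_, by rw [scan_append, h.2, scan_cons, hc.2, scan_nil]⟩
  rw [← List.append_assoc]
  exact valid_concat_iff.2 ⟨h.1, hc.1⟩

theorem cons_barred (h : Reads a b s q r) (hc : IsBarred c) (hfol : CanFollow a b s c) :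
    Reads a b s (c :: q) (psiLetter b s c :: r) := by
  have hcounts := hc.counts_concat (b := b) (s := s)
  constructor
  · rw [List.append_cons]
    exact Valid.append_congr h.1 hcounts.symm (valid_concat_iff.2 ⟨h.1.left, hfol⟩)
  · rw [scan_cons, scan_congr (isEncoding_psiLetter a b).congr hcounts, h.2]

theorem interchangeable {r' : List ℕ} (h : Reads a b s q r) (h' : Reads a b s q' r')
    (hN : ∀ j, N j q = N j q') : Interchangeable a b s q q' :=
  ⟨h.1, h'.1, h.1.counts_eq h'.1 fun j => by rw [N_append, N_append, hN]⟩

end Reads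

/-- The letters `c` and `c'` act on adjacent pairs of neighbouring positions, those of `c` first,
and `q` and `q'` are the two sides of the braid move that begin with `c` and `c'`. -/
inductive Braid (b : ℕ) (s : List Letter) : Letter → Letter → List Letter → List Letter → Prop
  | lower (p : ℕ) : Braid b s (lower p) (lower (p + 1))
      [lower p, lower (p + 1), lower p] [lower (p + 1), lower p, lower (p + 1)]
  | upper (p : ℕ) : Braid b s (upper p) (upper (p + 1))
      [upper p, upper (p + 1), upper p] [upper (p + 1), upper p, upper (p + 1)]
  | plainLower (p : ℕ) : Braid b s (plain p) (lower p)
      [plain p, plain (p + 1), lower p] [lower p, plain p, plain (p + 1)]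
  | upperPlain (p j : ℕ) : b - N j s = p + 1 → Braid b s (upper p) (plain j)
      [upper p, plain j, plain j] [plain j, plain j, upper p]

namespace Valid

variable {c c' : Letter} {x y z i p j : ℕ}

theorem psiLetter_eq_succ_iff (hs : Valid a b s) (hc : CanFollow a b s c)
    (hc' : CanFollow a b s c') :
    psiLetter b s c' = psiLetter b s c + 1 ↔ ∃ q q', Braid b s c c' q q' := by
  obtain ⟨x, y, hcxy, hx, hy⟩ := hs.canFollow_iff.1 ⟨hc, rfl⟩
  obtain ⟨x', y', hcxy', hx', hy'⟩ := hs.canFollow_iff.1 ⟨hc', rfl⟩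
  rw [← hx', ← hy, hs.pos_bijective.injective.eq_iff]
  match c, c' with
  | lower p, lower q =>
    obtain ⟨-, rfl, rfl⟩ := hcxy
    obtain ⟨-, rfl, rfl⟩ := hcxy'
    refine ⟨fun h => ?_, by rintro ⟨_, _, ⟨⟩⟩; rfl⟩
    obtain rfl : q = p + 1 := by omega
    exact ⟨_, _, .lower p⟩
  | upper p, upper q =>
    obtain ⟨-, rfl, rfl⟩ := hcxy
    obtain ⟨-, rfl, rfl⟩ := hcxy'
    refine ⟨fun h => h ▸ ⟨_, _, .upper _⟩, by rintro ⟨_, _, ⟨⟩⟩; rfl⟩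
  | plain p, lower q =>
    obtain ⟨-, -, rfl⟩ := hcxy
    obtain ⟨-, rfl, rfl⟩ := hcxy'
    refine ⟨fun h => ?_, by rintro ⟨_, _, ⟨⟩⟩; rfl⟩
    obtain rfl : q = p := by omega
    exact ⟨_, _, .plainLower q⟩
  | upper p, plain j =>
    obtain ⟨-, rfl, rfl⟩ := hcxy
    obtain ⟨-, rfl⟩ := hs.conjugateCounts.canFollow_plain hcxy' (hx' ▸ hy')
    exact ⟨fun h => ⟨_, _, .upperPlain _ j h⟩, by rintro ⟨_, _, h⟩; cases h; assumption⟩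
  | plain p, plain q | plain p, upper q | lower p, plain q | lower p, upper q | upper p, lower q =>
    refine iff_of_false ?_ (by rintro ⟨_, _, ⟨⟩⟩)
    simp only [Exchanges] at hcxy hcxy'
    omega

theorem reads_barred_braid (hs : Valid a b s) (hc : CanFollow a b s c) (hc' : CanFollow a b s c')
    (hbar : IsBarred c) (hbar' : IsBarred c') :
    Reads a b s [c, c', c] [psiLetter b s c, psiLetter b s c', psiLetter b s c] :=
  ((((Reads.nil hs).cons_barred hbar hc).cons_barred hbar' hc').cons_barred hbar hc)

theorem reads_plain_plain {p q : ℕ} {u v k : ℕ} (hs : Valid a b s)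
    (hp : Exchanges a b (plain p) x y) (hx : pos b s x = i) (hy : pos b s y = i + 1)
    (hq : Exchanges a b (plain q) u v) (hu : pos b s (swap x y u) = k)
    (hv : pos b s (swap x y v) = k + 1) :
    Reads a b s [plain p, plain q] [i, k] ∧
      pos b (s ++ [plain p, plain q]) = pos b s ∘ swap x y ∘ swap u v := by
  have hpos := hs.pos_concat_plain_of_exchanges hp (hx ▸ hy)
  have hread := (Reads.nil hs).concat (by simpa using hs.canFollow_iff.2 ⟨x, y, hp, hx, hy⟩)
  rw [← Function.comp_apply (f := pos b s), ← hpos] at hu hv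
  have hpos' := Valid.pos_concat_plain_of_exchanges hread.1 hq (hu ▸ hv)
  refine ⟨hread.concat ((Valid.canFollow_iff hread.1).2 ⟨u, v, hq, hu, hv⟩), ?_⟩
  rw [← Function.comp_assoc, ← hpos]
  simpa using hpos'

theorem braid_plain_lower (hs : Valid a b s) (hp : CanFollow a b s (plain p))
    (hl : CanFollow a b s (lower p)) (h : psiLetter b s (lower p) = psiLetter b s (plain p) + 1) :
    Interchangeable a b s [plain p, plain (p + 1), lower p] [lower p, plain p, plain (p + 1)] ∧
      scan (psiLetter b) s [plain p, plain (p + 1), lower p] =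
        [psiLetter b s (plain p), psiLetter b s (lower p), psiLetter b s (plain p)] ∧
      scan (psiLetter b) s [lower p, plain p, plain (p + 1)] =
        [psiLetter b s (lower p), psiLetter b s (plain p), psiLetter b s (lower p)] := by
  obtain ⟨_, _, ⟨hpa, rfl, rfl⟩, hy, hz⟩ := hs.canFollow_iff.1 ⟨hl, rfl⟩
  obtain ⟨x, _, ⟨hpa', hxb, rfl⟩, hx, hy'⟩ := hs.canFollow_iff.1 ⟨hp, rfl⟩
  obtain ⟨hread, hpos⟩ := hs.reads_plain_plain (q := p + 1) (v := b + p + 1) ⟨hpa', hxb, rfl⟩ hx hy'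
    ⟨⟨by omega, hpa.2⟩, hxb, rfl⟩ (by rw [swap_apply_left, hy])
    (by rw [swap_apply_of_ne_of_ne (by omega) (by omega), hz])
  have hposy : pos b (s ++ [plain p, plain (p + 1)]) (b + p) = psiLetter b s (plain p) := by
    rw [hpos, Function.comp_apply, Function.comp_apply,
      swap_apply_of_ne_of_ne (a := x) (b := b + p + 1) (by omega) (by omega), swap_apply_right, hx]
  have hposz : pos b (s ++ [plain p, plain (p + 1)]) (b + p + 1) = psiLetter b s (plain p) + 1 := by
    rw [hpos, Function.comp_apply, Function.comp_apply, swap_apply_right, swap_apply_left, hy, h]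
  have hleft := hread.concat (c := lower p)
    ((Valid.canFollow_iff hread.1).2 ⟨_, _, ⟨hpa, rfl, rfl⟩, hposy, hposz⟩)
  have hright := hread.cons_barred (.lower p) hl
  exact ⟨hleft.interchangeable hright fun j => by simp [N, List.count_cons], hleft.2, hright.2⟩

theorem braid_upper_plain (hs : Valid a b s) (hp : CanFollow a b s (upper p))
    (hj : CanFollow a b s (plain j)) (h : b - N j s = p + 1) :
    Interchangeable a b s [upper p, plain j, plain j] [plain j, plain j, upper p] ∧
      scan (psiLetter b) s [upper p, plain j, plain j] =
        [psiLetter b s (upper p), psiLetter b s (plain j), psiLetter b s (upper p)] ∧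
      scan (psiLetter b) s [plain j, plain j, upper p] =
        [psiLetter b s (plain j), psiLetter b s (upper p), psiLetter b s (plain j)] := by
  obtain ⟨p, _, ⟨hpb, rfl, rfl⟩, hx, hy⟩ := hs.canFollow_iff.1 ⟨hp, rfl⟩
  obtain ⟨hjxy, hy', hz⟩ := hs.conjugateCounts.plain_exchanges hj
  rw [h] at hjxy hy'
  have hja := hjxy.1
  obtain ⟨hread, hpos⟩ := hs.reads_plain_plain (u := p) (v := b + j) hjxy hy' hz
    ⟨hja, ⟨hpb.1, by omega⟩, rfl⟩
    (by rw [swap_apply_of_ne_of_ne (by omega) (by omega), hx]) (by rw [swap_apply_right, hy])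
  have hposx : pos b (s ++ [plain j, plain j]) p = psiLetter b s (plain j) := by
    rw [hpos, Function.comp_apply, Function.comp_apply, swap_apply_left, swap_apply_right, hy']
  have hposy : pos b (s ++ [plain j, plain j]) (p + 1) = psiLetter b s (plain j) + 1 := by
    rw [hpos, Function.comp_apply, Function.comp_apply,
      swap_apply_of_ne_of_ne (a := p) (b := b + j) (by omega) (by omega), swap_apply_left, hz]
  have hright := hread.concat (c := upper p)
    ((Valid.canFollow_iff hread.1).2 ⟨_, _, ⟨hpb, rfl, rfl⟩, hposx, hposy⟩)
  have hleft := hread.cons_barred (.upper p) hp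
  exact ⟨hleft.interchangeable hright fun j => by simp [N, List.count_cons], hleft.2, hright.2⟩

theorem braid (hs : Valid a b s) (hc : CanFollow a b s c) (hc' : CanFollow a b s c')
    (h : Braid b s c c' q q') :
    Interchangeable a b s q q' ∧
      scan (psiLetter b) s q = [psiLetter b s c, psiLetter b s c', psiLetter b s c] ∧
      scan (psiLetter b) s q' = [psiLetter b s c', psiLetter b s c, psiLetter b s c'] := by
  have hsucc := (hs.psiLetter_eq_succ_iff hc hc').2 ⟨q, q', h⟩
  cases h with
  | lower p =>
    have hleft := hs.reads_barred_braid hc hc' (.lower p) (.lower (p + 1))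
    have hright := hs.reads_barred_braid hc' hc (.lower (p + 1)) (.lower p)
    exact ⟨hleft.interchangeable hright fun j => by simp [N], hleft.2, hright.2⟩
  | upper p =>
    have hleft := hs.reads_barred_braid hc hc' (.upper p) (.upper (p + 1))
    have hright := hs.reads_barred_braid hc' hc (.upper (p + 1)) (.upper p)
    exact ⟨hleft.interchangeable hright fun j => by simp [N], hleft.2, hright.2⟩
  | plainLower p => exact hs.braid_plain_lower hc hc' hsucc
  | upperPlain p j h => exact hs.braid_upper_plain hc hc' h

end Valid

theorem scan_fLetter_of_braid {p j : ℕ} (h : b - N j s = p + 1) :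
    scan (fLetter b) s [upper p, plain j, plain j] = [upper p, plain (p + 1), plain p] ∧
      scan (fLetter b) s [plain j, plain j, upper p] = [plain (p + 1), plain p, upper p] := by
  have hN : b - (N j s + 1) = p := by omega
  have hupper : N j [upper p, plain j] = 1 := by simp [N]
  simp [fLetter, h, hN, hupper]

/-- The word `w'` arises from `w` by replacing one side of a braid move, the side that begins with
the letter acting further to the left, by the other side. -/
def BraidExchange (a b : ℕ) (w w' : List Letter) : Prop :=
  ∃ s c c' q q', (Valid a b s ∧ CanFollow a b s c ∧ CanFollow a b s c') ∧
    Braid b s c c' q q' ∧ ReplacesAfter s q q' w w'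

theorem braidMove_psi_iff (hw : Valid a b w) (hw' : Valid a b w') :
    BraidMove (psi b w) (psi b w') ↔ BraidExchange a b w w' := by
  constructor
  · rintro ⟨R, T, i, h, h'⟩
    obtain ⟨s, c, c', hs, rfl, ⟨hc, rfl⟩, ⟨hc', hsucc⟩⟩ :=
      exists_next_letters_of_psi hw hw' (by simpa using h) (by simpa using h')
    obtain ⟨q, q', hq⟩ := (hs.psiLetter_eq_succ_iff hc hc').1 hsucc
    obtain ⟨hi, hpsi, hpsi'⟩ := hs.braid hc hc' hq
    rw [← hsucc] at h h'
    exact ⟨s, c, c', q, q', ⟨hs, hc, hc'⟩, hq,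
      (hi.replacesAfter_psi_iff hw hw').1 ⟨T, hpsi ▸ h, hpsi' ▸ h'⟩⟩
  · rintro ⟨s, c, c', q, q', ⟨hs, hc, hc'⟩, hq, h⟩
    have hsucc := (hs.psiLetter_eq_succ_iff hc hc').2 ⟨q, q', hq⟩
    obtain ⟨hi, hpsi, hpsi'⟩ := hs.braid hc hc' hq
    obtain ⟨T, hT, hT'⟩ := (hi.replacesAfter_psi_iff hw hw').2 h
    rw [hpsi, hsucc] at hT
    rw [hpsi', hsucc] at hT'
    exact ⟨psi b s, T, _, hT, hT'⟩

theorem HBraid.braidExchange (h : HBraid b w w') (hw : Valid a b w) (hw' : Valid a b w') :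
    BraidExchange a b w w' ∨ BraidExchange a b w' w := by
  cases h with
  | lowerLower p h =>
    obtain ⟨s, h⟩ := h
    exact .inl ⟨s, _, _, _, _, ReplacesAfter.head_canFollow h hw hw', .lower p, h⟩
  | upperUpper p h =>
    obtain ⟨s, h⟩ := h
    exact .inl ⟨s, _, _, _, _, ReplacesAfter.head_canFollow h hw hw', .upper p, h⟩
  | lowerPlain p h =>
    obtain ⟨s, h⟩ := h
    have h' := ReplacesAfter.symm h
    exact .inr ⟨s, _, _, _, _, h'.head_canFollow hw' hw, .plainLower p, h'⟩
  | upperPlain p h =>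
    obtain ⟨R, T, h, h'⟩ := h
    obtain ⟨s, j, hs, rfl, hp, hj, hk⟩ :=
      exists_next_letters_of_f hw hw' (by simpa using h) (by simpa using h')
    obtain ⟨hi, -⟩ := hs.braid_upper_plain hp hj hk
    obtain ⟨hf, hf'⟩ := scan_fLetter_of_braid hk
    exact .inl ⟨s, _, _, _, _, ⟨hs, hp, hj⟩, .upperPlain p j hk,
      (hi.replacesAfter_f_iff hw hw').1 ⟨T, hf ▸ h, hf' ▸ h'⟩⟩

theorem BraidExchange.hBraid (h : BraidExchange a b w w') (hw : Valid a b w) (hw' : Valid a b w') :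
    HBraid b w w' ∨ HBraid b w' w := by
  obtain ⟨s, c, c', q, q', ⟨hs, hc, hc'⟩, hq, h⟩ := h
  cases hq with
  | lower p => exact .inl (.lowerLower p ⟨s, h⟩)
  | upper p => exact .inl (.upperUpper p ⟨s, h⟩)
  | plainLower p => exact .inr (.lowerPlain p ⟨s, h.symm⟩)
  | upperPlain p j hk =>
    obtain ⟨hi, -⟩ := hs.braid_upper_plain hc hc' hk
    obtain ⟨hf, hf'⟩ := scan_fLetter_of_braid hk
    obtain ⟨T, hT, hT'⟩ := (hi.replacesAfter_f_iff hw hw').2 h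
    exact .inl (.upperPlain p ⟨f b s, T, hf ▸ hT, hf' ▸ hT'⟩)

theorem moves_iff (hw : Valid a b w) (hw' : Valid a b w') :
    ((CommMove (psi b w) (psi b w') ∨ BraidMove (psi b w) (psi b w')) ∨
        CommMove (psi b w') (psi b w) ∨ BraidMove (psi b w') (psi b w)) ↔
      ((HComm b w w' ∨ HBraid b w w') ∨ HComm b w' w ∨ HBraid b w' w) := by
  rw [commMove_psi_iff hw hw', commMove_psi_iff hw' hw, braidMove_psi_iff hw hw',
    braidMove_psi_iff hw' hw]
  constructor
  · rintro ((h | h) | h | h)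
    · exact (h.hComm hw hw').imp .inl .inl
    · exact (h.hBraid hw hw').imp .inr .inr
    · exact ((h.hComm hw' hw).imp .inl .inl).symm
    · exact ((h.hBraid hw' hw).imp .inr .inr).symm
  · rintro ((h | h) | h | h)
    · exact .inl (.inl (h.farExchange hw hw'))
    · exact (h.braidExchange hw hw').imp .inr .inr
    · exact .inr (.inl (h.farExchange hw' hw))
    · exact ((h.braidExchange hw' hw).imp .inr .inr).symm

end Moves

theorem psi_graph_iso {a b : ℕ} (α : Perm (Fin a)) (β : Perm (Fin b)) :
    ∃ e : graphH α β ≃g graphG (inflation21 α β),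
      ∀ w : vertexSet α β, (e w : List ℕ) = psi b (w : List Letter) := by
  have hbij := psi_bijOn α β
  refine ⟨⟨hbij.equiv _, fun {w w'} => ?_⟩, fun w => rfl⟩
  have hw := (mem_vertexSet_iff.1 w.2).1
  have hw' := (mem_vertexSet_iff.1 w'.2).1
  rw [graphG, graphH, SimpleGraph.fromRel_adj, SimpleGraph.fromRel_adj]
  exact and_congr (hbij.equiv _).injective.ne_iff (moves_iff hw hw')

end Inflation21

theorem theorem4p2 (a b : ℕ) (α : Equiv.Perm (Fin a)) (β : Equiv.Perm (Fin b)) :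
    Set.BijOn (Inflation21.psi b) (Inflation21.vertexSet α β)
      (Inflation21.reducedWords (Inflation21.inflation21 α β)) ∧
    ∃ φ : Inflation21.graphH α β ≃g Inflation21.graphG (Inflation21.inflation21 α β),
      ∀ w : Inflation21.vertexSet α β, (φ w : List ℕ) = Inflation21.psi b (w : List Inflation21.Letter) := 
  ⟨Inflation21.psi_bijOn α β, Inflation21.psi_graph_iso α β⟩
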